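/- **Conventions.** All C*-algebras are unital and $\otimes$ between C*-algebras is the minimal tensor product. A compact quantum group (CQG) is a pair $(\mathcal A,\Delta)$ of a unital C*-algebra $\mathcal A$ and a unital $*$-homomorphism $\Delta:\mathcal A\to\mathcal A\otimes\mathcal A$ with $(\Delta\otimes id)\Delta=(id\otimes\Delta)\Delta$ such that the linear spans of $\Delta(\mathcal A)(1\otimes\mathcal A)$ and $\Delta(\mathcal A)(\mathcal A\otimes 1)$ are dense in $\mathcal A\otimes\mathcal A$. A co-action of $(\mathcal A,\Delta)$ on a unital C*-algebra $B$ is a unital $*$-homomorphism $\alpha:B\to B\otimes\mathcal A$ with $(\alpha\otimes id)\alpha=(id\otimes\Delta)\alpha$ such that the linear span of $\alpha(B)(1\otimes\mathcal A)$ is dense in $B\otimes\mathcal A$. Let $(V,E)$ be a finite directed multigraph with source and target maps $s,t:E\to V$ and without isolated vertices, that is, $V=V^s\cup V^t$ where $V^s=s(E)$ and $V^t=t(E)$. Write $\chi_\tau$ ($\tau\in E$) for the canonical orthonormal basis of the Hilbert space $L^2(E)$ and $\chi_v$ for the indicator functions in $C(V)$. Let $S:C(V^s)\to B(L^2(E))$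 and $T:C(V^t)\to B(L^2(E))$ be given by $S(f)\chi_\tau=f(s(\tau))\chi_\tau$ and $T(f)\chi_\tau=f(t(\tau))\chi_\tau$. **Banica-type co-actions.** A linear map $\beta:L^2(E)\to L^2(E)\otimes\mathcal A$, $\beta(\chi_\tau)=\sum_{\sigma}\chi_\sigma\otimes u^\sigma_\tau$, is a bi-unitary co-representation if $\Delta(u^\sigma_\tau)=\sum_\rho u^\sigma_\rho\otimes u^\rho_\tau$ and both matrices $U=(u^\sigma_\tau)$ and $\overline U=(u^{\sigma*}_\tau)$ are unitary. Put $Ad_\beta(X)=U(X\otimes 1)U^*$ and $Ad_{\overline\beta}(X)=\overline U(X\otimes 1)\overline U^*$ for $X\in B(L^2(E))$. The CQG co-acts on $(V,E)$ via $\beta$ preserving its quantum symmetry in Banica's sense if $\beta$ is a bi-unitary co-representation and 1. $Ad_\beta(S(C(V^s)))\subseteq S(C(V^s))\otimes\mathcal A$; 2. $Ad_{\overline\beta}(T(C(V^t)))\subseteq T(C(V^t))\otimes\mathcal A$; 3. the maps $\alpha_s:C(V^s)\to C(V^s)\otimes\mathcal A$ and $\alpha_t:C(V^t)\to C(V^t)\otimes\mathcal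 A$ determined by $(S\otimes id)\alpha_s(f)=Ad_\beta(S(f))$ and $(T\otimes id)\alpha_t(f)=Ad_{\overline\beta}(T(f))$ both map $C(V^s\cap V^t)$ into $C(V^s\cap V^t)\otimes\mathcal A$ and agree on $C(V^s\cap V^t)$ (functions on a subset being extended by zero); 4. $\beta(\xi_0)=\xi_0\otimes 1$ for $\xi_0=\sum_{\tau\in E}\chi_\tau$. The induced map $\alpha:C(V)\to C(V)\otimes\mathcal A$ is the linear map with $\alpha(\chi_k)=\alpha_s(\chi_k)$ for $k\in V^s$ and $\alpha(\chi_k)=\alpha_t(\chi_k)$ for $k\in V^t$. **The correspondence.** Let $(L^2(E),\phi)$ be the C*-correspondence over $C(V)$ with right action $\chi_\tau\cdot f=f(t(\tau))\chi_\tau$, inner product $\langle\chi_\sigma,\chi_\tau\rangle_{C(V)}=\delta_{\sigma,\tau}\chi_{t(\sigma)}$ (linear in the second variable) and left action $\phi(f)\chi_\tau=f(s(\tau))\chi_\tau$. **Proposition.** Let a CQG $(\mathcal A,\Delta)$ co-act on $(V,E)$ via $\beta$ preserving its quantum symmetry in Banica's sense, and let $\alpha$ be the induced map on $C(V)$. Then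 $(\beta,\alpha)$ is a co-action of $(\mathcal A,\Delta)$ on the C*-correspondence $(L^2(E),\phi)$, that is, $\alpha$ is a co-action of $(\mathcal A,\Delta)$ on the C*-algebra $C(V)$ and 1. $(\beta\otimes id)\circ\beta=(id\otimes\Delta)\circ\beta$; 2. the linear span of $\beta(L^2(E))(1\otimes\mathcal A)$ is norm-dense in $L^2(E)\otimes\mathcal A$; 3. $\beta(\phi(f)\xi)=(\phi\otimes id)(\alpha(f))\,\beta(\xi)$ for all $f\in C(V)$, $\xi\in L^2(E)$; 4. $\langle\beta(\xi),\beta(\eta)\rangle_{C(V)\otimes\mathcal A}=\alpha(\langle\xi,\eta\rangle_{C(V)})$ for all $\xi,\eta\in L^2(E)$, where $\langle\xi\otimes a,\eta\otimes b\rangle_{C(V)\otimes\mathcal A}=\langle\xi,\eta\rangle_{C(V)}\otimes a^*b$. -/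

import Mathlib

open scoped TensorProduct

universe u v w

/-! ### C⋆-completions of ⋆-algebras -/

/-- A C⋆-seminorm on a unital complex ⋆-algebra. -/
structure CStarSeminorm (P : Type u) [Ring P] [StarRing P] [Algebra ℂ P] where
  toFun : P → ℝ
  add_le : ∀ x y, toFun (x + y) ≤ toFun x + toFun y
  smul_eq : ∀ (c : ℂ) x, toFun (c • x) = ‖c‖ * toFun x
  mul_le : ∀ x y, toFun (x * y) ≤ toFun x * toFun y
  star_eq : ∀ x, toFun (star x) = toFun x
  cstar : ∀ x, toFun (star x * x) = toFun x * toFun x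

namespace CStarSeminorm

section

variable {P : Type u} [Ring P] [StarRing P] [Algebra ℂ P]

theorem zero_eq (p : CStarSeminorm P) : p.toFun 0 = 0 := by
  have h := p.smul_eq 0 0
  rwa [norm_zero, zero_mul, smul_zero] at h

theorem neg_eq (p : CStarSeminorm P) (x : P) : p.toFun (-x) = p.toFun x := by
  have h := p.smul_eq (-1) x
  rwa [norm_neg, norm_one, one_mul, neg_smul, one_smul] at h

/-- The ⋆-algebra `P` regarded as a seminormed ⋆-algebra through the C⋆-seminorm `p`. -/
def Pre (_p : CStarSeminorm P) : Type u := P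

variable (p : CStarSeminorm P)

instance : Ring p.Pre := inferInstanceAs (Ring P)
instance : StarRing p.Pre := inferInstanceAs (StarRing P)
instance : Algebra ℂ p.Pre := inferInstanceAs (Algebra ℂ P)

noncomputable instance : SeminormedRing p.Pre :=
  RingSeminorm.toSeminormedRing
    { toFun := p.toFun
      map_zero' := p.zero_eq
      add_le' := p.add_le
      neg' := p.neg_eq
      mul_le' := p.mul_le }

theorem pre_norm (x : p.Pre) : ‖x‖ = p.toFun x := rfl

noncomputable instance : NormedAlgebra ℂ p.Pre where
  norm_smul_le c x := (p.smul_eq c x).le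

instance : NormedStarGroup p.Pre where
  norm_star_le x := (p.star_eq x).le

end

variable {P : Type u} [Ring P] [StarRing P] [Algebra ℂ P] [StarModule ℂ P]
variable (p : CStarSeminorm P)

instance : StarModule ℂ p.Pre := inferInstanceAs (StarModule ℂ P)

open UniformSpace

/-- The separated completion of a ⋆-algebra with respect to a C⋆-seminorm. -/
abbrev Completed : Type u := Completion p.Pre

noncomputable instance : Star p.Completed := ⟨Completion.map star⟩

theorem uniformContinuous_star_pre : UniformContinuous (star : p.Pre → p.Pre) :=
  AddMonoidHomClass.uniformContinuous_of_bound (starAddEquiv : p.Pre ≃+ p.Pre) 1 fun x => by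
    rw [one_mul]
    exact (p.star_eq x).le

theorem star_coe (x : p.Pre) : star (x : p.Completed) = ((star x : p.Pre) : p.Completed) :=
  Completion.map_coe p.uniformContinuous_star_pre x

theorem continuous_star_completed : Continuous (star : p.Completed → p.Completed) :=
  Completion.continuous_map

noncomputable instance : StarRing p.Completed where
  star_involutive x := by
    have h := p.continuous_star_completed
    induction x using Completion.induction_on with
    | hp => exact isClosed_eq (h.comp h) continuous_id
    | ih x => rw [star_coe, star_coe, star_star]
  star_mul x y := by
    have h := p.continuous_star_completed
    induction x, y using Completion.induction_on₂ with
    | hp => exact isClosed_eq (by fun_prop) (by fun_prop)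
    | ih x y => rw [star_coe, star_coe, ← Completion.coe_mul, star_coe, star_mul,
        Completion.coe_mul]
  star_add x y := by
    have h := p.continuous_star_completed
    induction x, y using Completion.induction_on₂ with
    | hp => exact isClosed_eq (by fun_prop) (by fun_prop)
    | ih x y => rw [star_coe, star_coe, ← Completion.coe_add, star_coe, star_add,
        Completion.coe_add]

instance : StarModule ℂ p.Completed where
  star_smul c x := by
    have h := p.continuous_star_completed
    induction x using Completion.induction_on with
    | hp => exact isClosed_eq (h.comp (continuous_const_smul c))
              ((continuous_const_smul (star c)).comp h)
    | ih x => rw [star_coe, ← Completion.coe_smul, star_coe, star_smul, Completion.coe_smul]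

theorem star_mul_self_coe (x : p.Pre) :
    ‖(x : p.Completed)‖ * ‖(x : p.Completed)‖ = ‖star (x : p.Completed) * (x : p.Completed)‖ := by
  rw [star_coe, ← Completion.coe_mul, Completion.norm_coe, Completion.norm_coe]
  exact (p.cstar x).symm

instance : CStarRing p.Completed where
  norm_mul_self_le x := by
    have h := p.continuous_star_completed
    induction x using Completion.induction_on with
    | hp => exact isClosed_le (continuous_norm.mul continuous_norm)
              ((h.mul continuous_id).norm)
    | ih x => exact (p.star_mul_self_coe x).le

/-- The completion of a ⋆-algebra with respect to a C⋆-seminorm is a C⋆-algebra. -/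
noncomputable instance : CStarAlgebra p.Completed where
  norm_smul_le := norm_smul_le

/-- The identity map of `P`, with values in the seminormed ⋆-algebra. -/
def toPre : P →⋆ₐ[ℂ] p.Pre := StarAlgHom.id ℂ P

/-- The canonical ⋆-homomorphism of a ⋆-algebra into its completion. -/
noncomputable def incl : P →⋆ₐ[ℂ] p.Completed where
  toFun x := (p.toPre x : p.Completed)
  map_one' := Completion.coe_one _
  map_mul' x y := Completion.coe_mul (p.toPre x) (p.toPre y)
  map_zero' := Completion.coe_zero
  map_add' x y := Completion.coe_add (p.toPre x) (p.toPre y)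
  commutes' _ := rfl
  map_star' x := (p.star_coe (p.toPre x)).symm

theorem incl_apply (x : P) : p.incl x = (p.toPre x : p.Completed) := rfl

theorem norm_incl (x : P) : ‖p.incl x‖ = p.toFun x := Completion.norm_coe (p.toPre x)

theorem denseRange_incl : DenseRange p.incl :=
  (Completion.denseRange_coe (α := p.Pre)).comp Function.surjective_id.denseRange
    (Completion.continuous_coe _)

variable {C : Type v} [CStarAlgebra C]

theorem uniformContinuous_of_le (f : P →⋆ₐ[ℂ] C) (hf : ∀ x, ‖f x‖ ≤ p.toFun x) :
    UniformContinuous (fun x : p.Pre => f x) := by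
  let g : p.Pre →+ C := (f : P →+ C)
  refine AddMonoidHomClass.uniformContinuous_of_bound g 1 fun x => ?_
  rw [one_mul]
  exact hf x

/-- The continuous extension to the completion. -/
noncomputable def ext (f : P →⋆ₐ[ℂ] C) : p.Completed → C :=
  Completion.extension (fun x : p.Pre => f x)

theorem continuous_ext (f : P →⋆ₐ[ℂ] C) : Continuous (p.ext f) :=
  Completion.continuous_extension

theorem ext_coe (f : P →⋆ₐ[ℂ] C) (hf : ∀ x, ‖f x‖ ≤ p.toFun x) (x : p.Pre) :
    p.ext f (x : p.Completed) = f x :=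
  Completion.extension_coe (p.uniformContinuous_of_le f hf) x

/-- A ⋆-homomorphism into a C⋆-algebra that is dominated by the C⋆-seminorm extends to the
completion. -/
noncomputable def lift (f : P →⋆ₐ[ℂ] C) (hf : ∀ x, ‖f x‖ ≤ p.toFun x) : p.Completed →⋆ₐ[ℂ] C where
  toFun := p.ext f
  map_one' := by rw [← Completion.coe_one, p.ext_coe f hf]; exact map_one f
  map_zero' := by rw [← Completion.coe_zero, p.ext_coe f hf]; exact map_zero f
  map_mul' := fun x y => by
    have hc := p.continuous_ext f
    induction x, y using Completion.induction_on₂ with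
    | hp => exact isClosed_eq (hc.comp continuous_mul)
              ((hc.comp continuous_fst).mul (hc.comp continuous_snd))
    | ih x y =>
      rw [← Completion.coe_mul, p.ext_coe f hf, p.ext_coe f hf, p.ext_coe f hf]
      exact map_mul f x y
  map_add' := fun x y => by
    have hc := p.continuous_ext f
    induction x, y using Completion.induction_on₂ with
    | hp => exact isClosed_eq (hc.comp continuous_add)
              ((hc.comp continuous_fst).add (hc.comp continuous_snd))
    | ih x y =>
      rw [← Completion.coe_add, p.ext_coe f hf, p.ext_coe f hf, p.ext_coe f hf]
      exact map_add f x y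
  commutes' := fun c => (p.ext_coe f hf _).trans (AlgHomClass.commutes f c)
  map_star' := fun x => by
    have h := p.continuous_star_completed
    have hc := p.continuous_ext f
    induction x using Completion.induction_on with
    | hp => exact isClosed_eq (hc.comp h) hc.star
    | ih x =>
      rw [star_coe, p.ext_coe f hf, p.ext_coe f hf]
      exact map_star f x

theorem lift_incl (f : P →⋆ₐ[ℂ] C) (hf : ∀ x, ‖f x‖ ≤ p.toFun x) (x : P) :
    p.lift f hf (p.incl x) = f x :=
  p.ext_coe f hf (p.toPre x)

theorem continuous_lift (f : P →⋆ₐ[ℂ] C) (hf : ∀ x, ‖f x‖ ≤ p.toFun x) :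
    Continuous (p.lift f hf) :=
  p.continuous_ext f

/-- The supremum of a nonempty, pointwise bounded family of C⋆-seminorms induced by
⋆-homomorphisms into C⋆-algebras. -/
noncomputable def ofFamily {I : Type w} [Nonempty I] (C : I → Type v) [∀ i, CStarAlgebra (C i)]
    (f : ∀ i, P →⋆ₐ[ℂ] C i) (hb : ∀ x, BddAbove (Set.range fun i => ‖f i x‖)) :
    CStarSeminorm P where
  toFun x := ⨆ i, ‖f i x‖
  add_le x y := ciSup_le fun i => by
    rw [map_add]
    exact (norm_add_le _ _).trans (add_le_add (le_ciSup (hb x) i) (le_ciSup (hb y) i))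
  smul_eq c x := by
    simp only [map_smul, norm_smul]
    exact (Real.mul_iSup_of_nonneg (norm_nonneg c) _).symm
  mul_le x y := ciSup_le fun i => by
    rw [map_mul]
    exact (norm_mul_le _ _).trans (mul_le_mul (le_ciSup (hb x) i) (le_ciSup (hb y) i)
      (norm_nonneg _) (Real.iSup_nonneg fun _ => norm_nonneg _))
  star_eq x := by simp only [map_star, norm_star]
  cstar x := by
    apply le_antisymm
    · refine ciSup_le fun i => ?_
      rw [map_mul, map_star, CStarRing.norm_star_mul_self]
      exact mul_le_mul (le_ciSup (hb x) i) (le_ciSup (hb x) i)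
        (norm_nonneg _) (Real.iSup_nonneg fun _ => norm_nonneg _)
    · have h0 : 0 ≤ ⨆ i, ‖f i (star x * x)‖ := Real.iSup_nonneg fun _ => norm_nonneg _
      have h : (⨆ i, ‖f i x‖) ≤ √(⨆ i, ‖f i (star x * x)‖) := ciSup_le fun i => by
        apply Real.le_sqrt_of_sq_le
        rw [sq, ← CStarRing.norm_star_mul_self, ← map_star, ← map_mul]
        exact le_ciSup (hb (star x * x)) i
      calc _ ≤ √(⨆ i, ‖f i (star x * x)‖) * √(⨆ i, ‖f i (star x * x)‖) :=
            mul_le_mul h h (Real.iSup_nonneg fun _ => norm_nonneg _) (Real.sqrt_nonneg _)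
        _ = _ := Real.mul_self_sqrt h0

theorem norm_le_of_lift {I : Type w} (D : I → Type v) [∀ i, CStarAlgebra (D i)]
    (f : ∀ i, P →⋆ₐ[ℂ] D i) (hf : ∀ i x, ‖f i x‖ ≤ p.toFun x)
    (hp : ∀ (x : P) (c : ℝ), (∀ i, ‖f i x‖ ≤ c) → p.toFun x ≤ c) (z : p.Completed) (c : ℝ)
    (h : ∀ i, ‖p.lift (f i) (hf i) z‖ ≤ c) : ‖z‖ ≤ c := by
  refine le_of_forall_pos_le_add fun ε hε => ?_
  obtain ⟨x, hx⟩ := p.denseRange_incl.exists_dist_lt z (half_pos hε)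
  rw [dist_eq_norm] at hx
  have h1 : ‖p.incl x‖ ≤ c + ε / 2 := by
    rw [norm_incl]
    refine hp x _ fun i => ?_
    have h2 := NonUnitalStarAlgHom.norm_apply_le (p.lift (f i) (hf i)) (z - p.incl x)
    rw [map_sub, lift_incl] at h2
    calc ‖f i x‖ ≤ ‖p.lift (f i) (hf i) z‖ + ‖p.lift (f i) (hf i) z - f i x‖ :=
            norm_le_insert _ _
      _ ≤ c + ε / 2 := add_le_add (h i) (h2.trans hx.le)
  calc ‖z‖ ≤ ‖p.incl x‖ + ‖z - p.incl x‖ := norm_le_insert' _ _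
    _ ≤ (c + ε / 2) + ε / 2 := add_le_add h1 hx.le
    _ = c + ε := by ring

end CStarSeminorm

/-! ### Hilbert space tensor products and representations -/

section HilbertTensor

open UniformSpace TensorProduct

variable {H : Type u} [NormedAddCommGroup H] [InnerProductSpace ℂ H]
variable {K : Type v} [NormedAddCommGroup K] [InnerProductSpace ℂ K]

variable (H K) in
/-- The Hilbert space tensor product: the completion of the algebraic tensor product. -/
def HilbertTensor : Type (max u v) := Completion (H ⊗[ℂ] K)

noncomputable instance : NormedAddCommGroup (HilbertTensor H K) :=
  inferInstanceAs (NormedAddCommGroup (Completion (H ⊗[ℂ] K)))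

noncomputable instance : InnerProductSpace ℂ (HilbertTensor H K) :=
  inferInstanceAs (InnerProductSpace ℂ (Completion (H ⊗[ℂ] K)))

instance : CompleteSpace (HilbertTensor H K) :=
  inferInstanceAs (CompleteSpace (Completion (H ⊗[ℂ] K)))

namespace HilbertTensor

variable (H K) in
/-- The isometric embedding of the algebraic tensor product into the Hilbert space tensor
product. -/
noncomputable def ofAlg : H ⊗[ℂ] K →ₗᵢ[ℂ] HilbertTensor H K :=
  (Completion.toComplₗᵢ : H ⊗[ℂ] K →ₗᵢ[ℂ] Completion (H ⊗[ℂ] K))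

theorem denseRange_ofAlg : DenseRange (ofAlg H K) :=
  Completion.denseRange_coe (α := H ⊗[ℂ] K)

/-- The elementary tensor of two vectors in the Hilbert space tensor product. -/
noncomputable def vec (x : H) (y : K) : HilbertTensor H K := ofAlg H K (x ⊗ₜ y)

theorem inner_vec (x x' : H) (y y' : K) :
    inner ℂ (vec x y) (vec x' y') = inner ℂ x x' * inner ℂ y y' := by
  rw [vec, vec, LinearIsometry.inner_map_map, inner_tmul]

theorem continuous_vec : Continuous fun p : H × K => vec p.1 p.2 :=
  (ofAlg H K).continuous.comp continuous_tmul

theorem mem_of_vec (R : Submodule ℂ (HilbertTensor H K))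
    (hR : IsClosed (R : Set (HilbertTensor H K))) (h : ∀ x y, vec x y ∈ R) (z) : z ∈ R := by
  refine denseRange_ofAlg.induction_on z hR fun z => ?_
  induction z with
  | zero => rw [map_zero]; exact R.zero_mem
  | tmul x y => exact h x y
  | add a b ha hb => rw [map_add]; exact R.add_mem ha hb

theorem op_ext {S T : HilbertTensor H K →L[ℂ] HilbertTensor H K}
    (h : ∀ (x : H) (y : K), S (vec x y) = T (vec x y)) : S = T := by
  ext z
  let D : HilbertTensor H K →L[ℂ] HilbertTensor H K := S - T
  have h2 : z ∈ (D : HilbertTensor H K →ₗ[ℂ] HilbertTensor H K).ker :=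
    mem_of_vec _ D.isClosed_ker (fun x y => LinearMap.mem_ker.mpr (sub_eq_zero.mpr (h x y))) z
  exact sub_eq_zero.mp (LinearMap.mem_ker.mp h2)

end HilbertTensor

open HilbertTensor

/-- The operator `S ⊗ T` on the Hilbert space tensor product. -/
noncomputable def opTensor (S : H →L[ℂ] H) (T : K →L[ℂ] K) :
    HilbertTensor H K →L[ℂ] HilbertTensor H K :=
  ((mapL S T).completion : Completion (H ⊗[ℂ] K) →L[ℂ] Completion (H ⊗[ℂ] K))

theorem opTensor_ofAlg (S : H →L[ℂ] H) (T : K →L[ℂ] K) (x : H ⊗[ℂ] K) :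
    opTensor S T (ofAlg H K x) = ofAlg H K (mapL S T x) :=
  ContinuousLinearMap.completion_apply_coe (mapL S T) x

theorem opTensor_vec (S : H →L[ℂ] H) (T : K →L[ℂ] K) (x : H) (y : K) :
    opTensor S T (vec x y) = vec (S x) (T y) := by
  rw [vec, opTensor_ofAlg, mapL_tmul, vec]

theorem vec_add_left (x x' : H) (y : K) : vec (x + x') y = vec x y + vec x' y := by
  rw [vec, add_tmul, map_add]; rfl

theorem vec_add_right (x : H) (y y' : K) : vec x (y + y') = vec x y + vec x y' := by
  rw [vec, tmul_add, map_add]; rfl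

theorem vec_smul_left (c : ℂ) (x : H) (y : K) : vec (c • x) y = c • vec x y := by
  rw [vec, ← smul_tmul', map_smul]; rfl

theorem vec_smul_right (c : ℂ) (x : H) (y : K) : vec x (c • y) = c • vec x y := by
  rw [vec, tmul_smul, map_smul]; rfl

theorem opTensor_mul (S S' : H →L[ℂ] H) (T T' : K →L[ℂ] K) :
    opTensor (S * S') (T * T') = opTensor S T * opTensor S' T' :=
  op_ext fun x y => by
    rw [mul_apply_eq_comp]
    simp only [opTensor_vec, mul_apply_eq_comp]

theorem opTensor_one : opTensor (1 : H →L[ℂ] H) (1 : K →L[ℂ] K) = 1 :=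
  op_ext fun x y => by
    simp only [opTensor_vec, one_apply_eq_self]

theorem opTensor_add_left (S S' : H →L[ℂ] H) (T : K →L[ℂ] K) :
    opTensor (S + S') T = opTensor S T + opTensor S' T :=
  op_ext fun x y => by
    simp only [opTensor_vec, add_apply, vec_add_left]

theorem opTensor_add_right (S : H →L[ℂ] H) (T T' : K →L[ℂ] K) :
    opTensor S (T + T') = opTensor S T + opTensor S T' :=
  op_ext fun x y => by
    simp only [opTensor_vec, add_apply, vec_add_right]

theorem opTensor_smul_left (c : ℂ) (S : H →L[ℂ] H) (T : K →L[ℂ] K) :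
    opTensor (c • S) T = c • opTensor S T :=
  op_ext fun x y => by
    simp only [opTensor_vec, smul_apply, vec_smul_left]

theorem opTensor_smul_right (c : ℂ) (S : H →L[ℂ] H) (T : K →L[ℂ] K) :
    opTensor S (c • T) = c • opTensor S T :=
  op_ext fun x y => by
    simp only [opTensor_vec, smul_apply, vec_smul_right]

theorem opTensor_star [CompleteSpace H] [CompleteSpace K] (S : H →L[ℂ] H) (T : K →L[ℂ] K) :
    opTensor (star S) (star T) = star (opTensor S T) := by
  have key : ∀ x y : H ⊗[ℂ] K,
      inner ℂ (mapL (star S) (star T) x) y = inner ℂ x (mapL S T y) := by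
    intro x y
    induction x with
    | zero => simp
    | add a b ha hb => rw [map_add, inner_add_left, inner_add_left, ha, hb]
    | tmul h k =>
      induction y with
      | zero => simp
      | add a b ha hb => rw [map_add, inner_add_right, inner_add_right, ha, hb]
      | tmul h' k' =>
        simp [ContinuousLinearMap.star_eq_adjoint, ContinuousLinearMap.adjoint_inner_left]
  refine (ContinuousLinearMap.eq_adjoint_iff _ _).mpr fun x y => ?_
  refine denseRange_ofAlg.induction_on₂
    (p := fun x y => inner ℂ (opTensor (star S) (star T) x) y = inner ℂ x (opTensor S T y))
    (isClosed_eq (((opTensor _ _).continuous.comp continuous_fst).inner continuous_snd)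
      (continuous_fst.inner ((opTensor _ _).continuous.comp continuous_snd))) (fun x y => ?_) x y
  rw [opTensor_ofAlg, opTensor_ofAlg, LinearIsometry.inner_map_map, LinearIsometry.inner_map_map,
    key]

theorem norm_opTensor_le (S : H →L[ℂ] H) (T : K →L[ℂ] K) : ‖opTensor S T‖ ≤ ‖S‖ * ‖T‖ := by
  refine ContinuousLinearMap.opNorm_le_bound _ (by positivity) fun z => ?_
  refine denseRange_ofAlg.induction_on z
    (isClosed_le (opTensor S T).continuous.norm (continuous_const.mul continuous_norm)) fun z => ?_
  rw [opTensor_ofAlg, LinearIsometry.norm_map, LinearIsometry.norm_map]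
  exact ((mapL S T).le_opNorm z).trans
    (mul_le_mul_of_nonneg_right (norm_mapL_le S T) (norm_nonneg z))

variable [CompleteSpace H] [CompleteSpace K]

/-- The operator-valued bilinear map `(S, T) ↦ S ⊗ T`. -/
noncomputable def opTensorₗ : (H →L[ℂ] H) →ₗ[ℂ] (K →L[ℂ] K) →ₗ[ℂ]
    (HilbertTensor H K →L[ℂ] HilbertTensor H K) :=
  LinearMap.mk₂ ℂ opTensor opTensor_add_left opTensor_smul_left opTensor_add_right
    opTensor_smul_right

variable {P : Type*} [Ring P] [StarRing P] [Algebra ℂ P] [StarModule ℂ P]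
variable {Q : Type*} [Ring Q] [StarRing Q] [Algebra ℂ Q] [StarModule ℂ Q]

/-- The algebra homomorphism underlying `repTensor`. -/
noncomputable def repTensorAlg (f : P →⋆ₐ[ℂ] (H →L[ℂ] H)) (g : Q →⋆ₐ[ℂ] (K →L[ℂ] K)) :
    P ⊗[ℂ] Q →ₐ[ℂ] (HilbertTensor H K →L[ℂ] HilbertTensor H K) :=
  Algebra.TensorProduct.algHomOfLinearMapTensorProduct
    (TensorProduct.lift (opTensorₗ.compl₁₂ (f : P →ₐ[ℂ] _).toLinearMap
      (g : Q →ₐ[ℂ] _).toLinearMap))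
    (fun p₁ p₂ q₁ q₂ => by
      change opTensor (f (p₁ * p₂)) (g (q₁ * q₂)) = opTensor (f p₁) (g q₁) * opTensor (f p₂) (g q₂)
      rw [map_mul, map_mul, opTensor_mul])
    (by
      change opTensor (f 1) (g 1) = 1
      rw [map_one, map_one, opTensor_one])

theorem repTensorAlg_tmul (f : P →⋆ₐ[ℂ] (H →L[ℂ] H)) (g : Q →⋆ₐ[ℂ] (K →L[ℂ] K)) (p : P) (q : Q) :
    repTensorAlg f g (p ⊗ₜ q) = opTensor (f p) (g q) := rfl

/-- The tensor product `f ⊗ g` of two ⋆-representations, on the algebraic tensor product of the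
⋆-algebras: `p ⊗ q` acts as `f p ⊗ g q` on the Hilbert space tensor product. -/
noncomputable def repTensor (f : P →⋆ₐ[ℂ] (H →L[ℂ] H)) (g : Q →⋆ₐ[ℂ] (K →L[ℂ] K)) :
    P ⊗[ℂ] Q →⋆ₐ[ℂ] (HilbertTensor H K →L[ℂ] HilbertTensor H K) :=
  { repTensorAlg f g with
    map_star' := fun x => by
      change repTensorAlg f g (star x) = star (repTensorAlg f g x)
      induction x with
      | zero =>
        rw [star_zero, map_zero]
        exact (star_zero _).symm
      | tmul p q =>
        rw [star_tmul, repTensorAlg_tmul, repTensorAlg_tmul, map_star, map_star, opTensor_star]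
      | add a b ha hb =>
        rw [star_add, map_add, map_add, ha, hb]
        exact (star_add _ _).symm }

theorem repTensor_tmul (f : P →⋆ₐ[ℂ] (H →L[ℂ] H)) (g : Q →⋆ₐ[ℂ] (K →L[ℂ] K)) (p : P) (q : Q) :
    repTensor f g (p ⊗ₜ q) = opTensor (f p) (g q) := rfl

end HilbertTensor

section Comparison

open UniformSpace TensorProduct

variable {H : Type u} [NormedAddCommGroup H] [InnerProductSpace ℂ H]
variable {K : Type u} [NormedAddCommGroup K] [InnerProductSpace ℂ K]
variable {L : Type u} [NormedAddCommGroup L] [InnerProductSpace ℂ L]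

open HilbertTensor

variable (H K L) in
/-- The algebraic triple tensor product inside `H ⊗ (K ⊗ L)`. -/
noncomputable def toRight : (H ⊗[ℂ] K) ⊗[ℂ] L →ₗᵢ[ℂ] HilbertTensor H (HilbertTensor K L) :=
  ((ofAlg H (HilbertTensor K L)).comp (mapIsometry LinearIsometry.id (ofAlg K L))).comp
    (assocIsometry ℂ H K L).toLinearIsometry

variable (H K L) in
/-- The algebraic triple tensor product inside `(H ⊗ K) ⊗ L`. -/
noncomputable def toLeft : (H ⊗[ℂ] K) ⊗[ℂ] L →ₗᵢ[ℂ] HilbertTensor (HilbertTensor H K) L :=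
  (ofAlg (HilbertTensor H K) L).comp (mapIsometry (ofAlg H K) LinearIsometry.id)

theorem toRight_tmul (h : H) (k : K) (l : L) :
    toRight H K L ((h ⊗ₜ k) ⊗ₜ l) = vec h (vec k l) := rfl

theorem toLeft_tmul (h : H) (k : K) (l : L) :
    toLeft H K L ((h ⊗ₜ k) ⊗ₜ l) = vec (vec h k) l := rfl

theorem denseRange_toRight : DenseRange (toRight H K L) := by
  let R := (LinearMap.range (toRight H K L).toLinearMap).topologicalClosure
  have hR : IsClosed (R : Set (HilbertTensor H (HilbertTensor K L))) :=
    Submodule.isClosed_topologicalClosure _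
  refine mem_of_vec R hR fun h y => ?_
  refine denseRange_ofAlg.induction_on (p := fun y => vec h y ∈ R) y
    (hR.preimage (continuous_vec.comp (continuous_const.prodMk continuous_id))) fun y => ?_
  induction y with
  | zero =>
    have h0 : vec h (0 : HilbertTensor K L) = 0 := by rw [vec, tmul_zero, map_zero]
    rw [map_zero, h0]; exact R.zero_mem
  | tmul k l =>
    exact Submodule.le_topologicalClosure _ ⟨(h ⊗ₜ k) ⊗ₜ l, toRight_tmul h k l⟩
  | add a b ha hb =>
    rw [map_add, vec_add_right]; exact R.add_mem ha hb

/-- Operators with the same matrix coefficients on the algebraic triple tensor product have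
comparable norms. -/
theorem norm_le_of_coeff
    (S : HilbertTensor H (HilbertTensor K L) →L[ℂ] HilbertTensor H (HilbertTensor K L))
    (T : HilbertTensor (HilbertTensor H K) L →L[ℂ] HilbertTensor (HilbertTensor H K) L)
    (hST : ∀ x y : (H ⊗[ℂ] K) ⊗[ℂ] L, inner ℂ (S (toRight H K L x)) (toRight H K L y) =
      inner ℂ (T (toLeft H K L x)) (toLeft H K L y)) : ‖S‖ ≤ ‖T‖ := by
  have h1 : ∀ (x y : HilbertTensor H (HilbertTensor K L)),
      ‖inner ℂ (S x) y‖ ≤ ‖T‖ * ‖x‖ * ‖y‖ := by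
    intro x y
    refine denseRange_toRight.induction_on₂ (p := fun x y => ‖inner ℂ (S x) y‖ ≤ ‖T‖ * ‖x‖ * ‖y‖)
      ?_ ?_ x y
    · exact isClosed_le ((S.continuous.comp continuous_fst).inner continuous_snd).norm
        ((continuous_const.mul continuous_fst.norm).mul continuous_snd.norm)
    · intro x y
      rw [hST]
      refine (norm_inner_le_norm _ _).trans ?_
      rw [LinearIsometry.norm_map, LinearIsometry.norm_map, LinearIsometry.norm_map]
      refine mul_le_mul_of_nonneg_right ((T.le_opNorm (toLeft H K L x)).trans ?_) (norm_nonneg y)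
      rw [LinearIsometry.norm_map]
  refine S.opNorm_le_bound (norm_nonneg _) fun x => ?_
  have h := h1 x (S x)
  rw [inner_self_eq_norm_sq_to_K, norm_pow, RCLike.norm_ofReal, abs_norm, sq] at h
  by_cases h0 : ‖S x‖ = 0
  · rw [h0]; positivity
  · exact le_of_mul_le_mul_right h (lt_of_le_of_ne (norm_nonneg _) (Ne.symm h0))

/-- To compare matrix coefficients it is enough to do so on elementary tensors. -/
theorem coeff_ext
    (S : HilbertTensor H (HilbertTensor K L) →L[ℂ] HilbertTensor H (HilbertTensor K L))
    (T : HilbertTensor (HilbertTensor H K) L →L[ℂ] HilbertTensor (HilbertTensor H K) L)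
    (hST : ∀ (h h' : H) (k k' : K) (l l' : L),
      inner ℂ (S (vec h (vec k l))) (vec h' (vec k' l')) =
      inner ℂ (T (vec (vec h k) l)) (vec (vec h' k') l'))
    (x y : (H ⊗[ℂ] K) ⊗[ℂ] L) : inner ℂ (S (toRight H K L x)) (toRight H K L y) =
      inner ℂ (T (toLeft H K L x)) (toLeft H K L y) := by
  have hy : ∀ (h : H) (k : K) (l : L),
      (innerₛₗ ℂ (S (toRight H K L ((h ⊗ₜ k) ⊗ₜ l)))) ∘ₗ (toRight H K L).toLinearMap =
      (innerₛₗ ℂ (T (toLeft H K L ((h ⊗ₜ k) ⊗ₜ l)))) ∘ₗ (toLeft H K L).toLinearMap :=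
    fun h k l => TensorProduct.ext_threefold fun h' k' l' => hST h h' k k' l l'
  have hx : (innerₛₗ ℂ (toRight H K L y)) ∘ₗ (S : _ →ₗ[ℂ] _) ∘ₗ (toRight H K L).toLinearMap =
      (innerₛₗ ℂ (toLeft H K L y)) ∘ₗ (T : _ →ₗ[ℂ] _) ∘ₗ (toLeft H K L).toLinearMap :=
    TensorProduct.ext_threefold fun h k l => by
      have := congrArg (starRingEnd ℂ) (LinearMap.congr_fun (hy h k l) y)
      simp only [LinearMap.comp_apply, innerₛₗ_apply_apply, inner_conj_symm] at this
      exact this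
  have := congrArg (starRingEnd ℂ) (LinearMap.congr_fun hx x)
  simp only [LinearMap.comp_apply, innerₛₗ_apply_apply, inner_conj_symm] at this
  exact this

end Comparison

/-! ### Minimal tensor products of C⋆-algebras -/

/-- A unital ⋆-representation of a C⋆-algebra on a Hilbert space. -/
structure StarRep (A : Type u) [CStarAlgebra A] : Type (u + 1) where
  /-- the Hilbert space -/
  H : Type u
  [normed : NormedAddCommGroup H]
  [innerProduct : InnerProductSpace ℂ H]
  [complete : CompleteSpace H]
  /-- the ⋆-homomorphism into the bounded operators -/
  π : A →⋆ₐ[ℂ] (H →L[ℂ] H)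

attribute [instance] StarRep.normed StarRep.innerProduct StarRep.complete

section MinTensor

open TensorProduct HilbertTensor

variable (A B C : Type u) [CStarAlgebra A] [CStarAlgebra B] [CStarAlgebra C]

/-- The representation on the zero space. -/
noncomputable instance : Nonempty (StarRep A) :=
  ⟨{ H := PUnit
     π :=
      { toFun := fun _ => 0
        map_one' := Subsingleton.elim _ _
        map_mul' := fun _ _ => Subsingleton.elim _ _
        map_zero' := rfl
        map_add' := fun _ _ => Subsingleton.elim _ _
        commutes' := fun _ => Subsingleton.elim _ _
        map_star' := fun _ => Subsingleton.elim _ _ } }⟩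

variable {A B C}

theorem bddAbove_repTensor (x : A ⊗[ℂ] B) :
    BddAbove (Set.range fun i : StarRep A × StarRep B => ‖repTensor i.1.π i.2.π x‖) := by
  suffices h : ∃ M : ℝ, ∀ i : StarRep A × StarRep B, ‖repTensor i.1.π i.2.π x‖ ≤ M by
    obtain ⟨M, hM⟩ := h
    exact ⟨M, by rintro _ ⟨i, rfl⟩; exact hM i⟩
  induction x with
  | zero => exact ⟨0, fun i => by rw [map_zero, norm_zero]⟩
  | tmul a b =>
    refine ⟨‖a‖ * ‖b‖, fun i => ?_⟩
    rw [repTensor_tmul]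
    exact (norm_opTensor_le _ _).trans (mul_le_mul (NonUnitalStarAlgHom.norm_apply_le i.1.π a)
      (NonUnitalStarAlgHom.norm_apply_le i.2.π b) (norm_nonneg _) (norm_nonneg _))
  | add x y hx hy =>
    obtain ⟨M, hM⟩ := hx
    obtain ⟨N, hN⟩ := hy
    refine ⟨M + N, fun i => ?_⟩
    rw [map_add]
    exact (norm_add_le _ _).trans (add_le_add (hM i) (hN i))

theorem bddAbove_repTensor₃ (x : A ⊗[ℂ] (B ⊗[ℂ] C)) :
    BddAbove (Set.range fun i : StarRep A × StarRep B × StarRep C =>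
      ‖repTensor i.1.π (repTensor i.2.1.π i.2.2.π) x‖) := by
  suffices h : ∃ M : ℝ, ∀ i : StarRep A × StarRep B × StarRep C,
      ‖repTensor i.1.π (repTensor i.2.1.π i.2.2.π) x‖ ≤ M by
    obtain ⟨M, hM⟩ := h
    exact ⟨M, by rintro _ ⟨i, rfl⟩; exact hM i⟩
  induction x with
  | zero => exact ⟨0, fun i => by rw [map_zero, norm_zero]⟩
  | tmul a y =>
    obtain ⟨M, hM⟩ := bddAbove_repTensor y
    refine ⟨‖a‖ * M, fun i => ?_⟩
    rw [repTensor_tmul]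
    exact (norm_opTensor_le _ _).trans (mul_le_mul (NonUnitalStarAlgHom.norm_apply_le i.1.π a)
      (hM ⟨i.2, rfl⟩) (norm_nonneg _) (norm_nonneg _))
  | add x y hx hy =>
    obtain ⟨M, hM⟩ := hx
    obtain ⟨N, hN⟩ := hy
    refine ⟨M + N, fun i => ?_⟩
    rw [map_add]
    exact (norm_add_le _ _).trans (add_le_add (hM i) (hN i))

variable (A B C)

/-- The minimal (spatial) C⋆-seminorm on the algebraic tensor product: the supremum of
`‖(π ⊗ ρ)(x)‖` over all pairs of representations. -/
noncomputable def minSeminorm : CStarSeminorm (A ⊗[ℂ] B) :=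
  CStarSeminorm.ofFamily (I := StarRep A × StarRep B)
    (fun i => HilbertTensor i.1.H i.2.H →L[ℂ] HilbertTensor i.1.H i.2.H)
    (fun i => repTensor i.1.π i.2.π) bddAbove_repTensor

/-- The minimal (spatial) C⋆-seminorm on the algebraic triple tensor product. -/
noncomputable def minSeminorm₃ : CStarSeminorm (A ⊗[ℂ] (B ⊗[ℂ] C)) :=
  CStarSeminorm.ofFamily (I := StarRep A × StarRep B × StarRep C)
    (fun i => HilbertTensor i.1.H (HilbertTensor i.2.1.H i.2.2.H) →L[ℂ]
      HilbertTensor i.1.H (HilbertTensor i.2.1.H i.2.2.H))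
    (fun i => repTensor i.1.π (repTensor i.2.1.π i.2.2.π)) bddAbove_repTensor₃

/-- The minimal C⋆-tensor product `A ⊗ B`. -/
def MinTensor : Type u := (minSeminorm A B).Completed

/-- The minimal C⋆-tensor product `A ⊗ B ⊗ C`. -/
def MinTensor₃ : Type u := (minSeminorm₃ A B C).Completed

noncomputable instance : CStarAlgebra (MinTensor A B) :=
  inferInstanceAs (CStarAlgebra (minSeminorm A B).Completed)

noncomputable instance : CStarAlgebra (MinTensor₃ A B C) :=
  inferInstanceAs (CStarAlgebra (minSeminorm₃ A B C).Completed)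

/-- The canonical map of the algebraic tensor product into `A ⊗ B`. -/
noncomputable def minIncl : A ⊗[ℂ] B →⋆ₐ[ℂ] MinTensor A B := (minSeminorm A B).incl

/-- The canonical map of the algebraic tensor product into `A ⊗ B ⊗ C`. -/
noncomputable def minIncl₃ : A ⊗[ℂ] (B ⊗[ℂ] C) →⋆ₐ[ℂ] MinTensor₃ A B C :=
  (minSeminorm₃ A B C).incl

theorem denseRange_minIncl : DenseRange (minIncl A B) := (minSeminorm A B).denseRange_incl

variable {A B C}

/-- The elementary tensor `a ⊗ b` in the minimal tensor product. -/
noncomputable def minTmul (a : A) (b : B) : MinTensor A B := minIncl A B (a ⊗ₜ[ℂ] b)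

theorem norm_rep_le (r : StarRep A) (s : StarRep B) (x : A ⊗[ℂ] B) :
    ‖repTensor r.π s.π x‖ ≤ (minSeminorm A B).toFun x :=
  le_ciSup (bddAbove_repTensor x) (r, s)

theorem norm_rep_le₃ (r : StarRep A) (s : StarRep B) (t : StarRep C) (x : A ⊗[ℂ] (B ⊗[ℂ] C)) :
    ‖repTensor r.π (repTensor s.π t.π) x‖ ≤ (minSeminorm₃ A B C).toFun x :=
  le_ciSup (bddAbove_repTensor₃ x) (r, s, t)

theorem minSeminorm_le (x : A ⊗[ℂ] B) (c : ℝ)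
    (h : ∀ (r : StarRep A) (s : StarRep B), ‖repTensor r.π s.π x‖ ≤ c) :
    (minSeminorm A B).toFun x ≤ c :=
  ciSup_le fun i => h i.1 i.2

theorem minSeminorm₃_le (x : A ⊗[ℂ] (B ⊗[ℂ] C)) (c : ℝ)
    (h : ∀ (r : StarRep A) (s : StarRep B) (t : StarRep C),
      ‖repTensor r.π (repTensor s.π t.π) x‖ ≤ c) : (minSeminorm₃ A B C).toFun x ≤ c :=
  ciSup_le fun i => h i.1 i.2.1 i.2.2

/-- The tensor product `r ⊗ s` of two representations, extended to `A ⊗ B`. -/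
noncomputable def tensorHom (r : StarRep A) (s : StarRep B) :
    MinTensor A B →⋆ₐ[ℂ] (HilbertTensor r.H s.H →L[ℂ] HilbertTensor r.H s.H) :=
  (minSeminorm A B).lift (repTensor r.π s.π) (norm_rep_le r s)

theorem tensorHom_minIncl (r : StarRep A) (s : StarRep B) (x : A ⊗[ℂ] B) :
    tensorHom r s (minIncl A B x) = repTensor r.π s.π x :=
  (minSeminorm A B).lift_incl _ (norm_rep_le r s) x

theorem continuous_tensorHom (r : StarRep A) (s : StarRep B) : Continuous (tensorHom r s) :=
  (minSeminorm A B).continuous_lift _ _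

/-- The tensor product `r ⊗ s ⊗ t` of three representations, extended to `A ⊗ B ⊗ C`. -/
noncomputable def tensorHom₃ (r : StarRep A) (s : StarRep B) (t : StarRep C) :
    MinTensor₃ A B C →⋆ₐ[ℂ] (HilbertTensor r.H (HilbertTensor s.H t.H) →L[ℂ]
      HilbertTensor r.H (HilbertTensor s.H t.H)) :=
  (minSeminorm₃ A B C).lift (repTensor r.π (repTensor s.π t.π)) (norm_rep_le₃ r s t)

theorem tensorHom₃_minIncl₃ (r : StarRep A) (s : StarRep B) (t : StarRep C)
    (x : A ⊗[ℂ] (B ⊗[ℂ] C)) :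
    tensorHom₃ r s t (minIncl₃ A B C x) = repTensor r.π (repTensor s.π t.π) x :=
  (minSeminorm₃ A B C).lift_incl _ (norm_rep_le₃ r s t) x

theorem continuous_tensorHom₃ (r : StarRep A) (s : StarRep B) (t : StarRep C) :
    Continuous (tensorHom₃ r s t) :=
  (minSeminorm₃ A B C).continuous_lift _ _

theorem norm_le_of_rep₃ (z : MinTensor₃ A B C) (c : ℝ)
    (h : ∀ (r : StarRep A) (s : StarRep B) (t : StarRep C), ‖tensorHom₃ r s t z‖ ≤ c) :
    ‖z‖ ≤ c :=
  (minSeminorm₃ A B C).norm_le_of_lift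
    (fun i : StarRep A × StarRep B × StarRep C =>
      HilbertTensor i.1.H (HilbertTensor i.2.1.H i.2.2.H) →L[ℂ]
      HilbertTensor i.1.H (HilbertTensor i.2.1.H i.2.2.H))
    (fun i => repTensor i.1.π (repTensor i.2.1.π i.2.2.π))
    (fun i => norm_rep_le₃ i.1 i.2.1 i.2.2)
    (fun x c h => minSeminorm₃_le x c fun r s t => h (r, s, t)) z c fun i => h i.1 i.2.1 i.2.2

/-- The tensor product of two representations pulled back along a ⋆-homomorphism. -/
noncomputable def StarRep.tensorPullback {D : Type u} [CStarAlgebra D] (r : StarRep A)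
    (s : StarRep B) (f : D →⋆ₐ[ℂ] MinTensor A B) : StarRep D where
  H := HilbertTensor r.H s.H
  π := (tensorHom r s).comp f

end MinTensor

section Amplification

open TensorProduct HilbertTensor

section Algebraic

variable {P : Type u} [Ring P] [StarRing P] [Algebra ℂ P] [StarModule ℂ P]
variable {Q : Type v} [Ring Q] [StarRing Q] [Algebra ℂ Q] [StarModule ℂ Q]
variable {R : Type w} [Ring R] [StarRing R] [Algebra ℂ R] [StarModule ℂ R]

/-- Two ⋆-homomorphisms with commuting ranges induce a ⋆-homomorphism on the algebraic tensor
product, `p ⊗ q ↦ f p * g q`. -/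
noncomputable def starLift (f : P →⋆ₐ[ℂ] R) (g : Q →⋆ₐ[ℂ] R) (h : ∀ p q, Commute (f p) (g q)) :
    P ⊗[ℂ] Q →⋆ₐ[ℂ] R :=
  { Algebra.TensorProduct.lift (f : P →ₐ[ℂ] R) (g : Q →ₐ[ℂ] R) h with
    map_star' := fun x => by
      change Algebra.TensorProduct.lift (f : P →ₐ[ℂ] R) (g : Q →ₐ[ℂ] R) h (star x) =
        star (Algebra.TensorProduct.lift (f : P →ₐ[ℂ] R) (g : Q →ₐ[ℂ] R) h x)
      induction x with
      | zero => rw [star_zero, map_zero, star_zero]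
      | tmul p q =>
        rw [star_tmul, Algebra.TensorProduct.lift_tmul, Algebra.TensorProduct.lift_tmul, star_mul]
        change f (star p) * g (star q) = star (g q) * star (f p)
        rw [h, map_star, map_star]
      | add a b ha hb => rw [star_add, map_add, map_add, star_add, ha, hb] }

theorem starLift_tmul (f : P →⋆ₐ[ℂ] R) (g : Q →⋆ₐ[ℂ] R) (h : ∀ p q, Commute (f p) (g q))
    (p : P) (q : Q) : starLift f g h (p ⊗ₜ q) = f p * g q := rfl

variable (P Q) in
/-- `p ↦ p ⊗ 1`. -/
noncomputable def tmulOne : P →⋆ₐ[ℂ] P ⊗[ℂ] Q :=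
  { (Algebra.TensorProduct.includeLeft : P →ₐ[ℂ] P ⊗[ℂ] Q) with
    map_star' := fun x => by
      change star x ⊗ₜ[ℂ] (1 : Q) = star (x ⊗ₜ[ℂ] (1 : Q))
      rw [star_tmul, star_one] }

variable (P Q) in
/-- `q ↦ 1 ⊗ q`. -/
noncomputable def oneTmul : Q →⋆ₐ[ℂ] P ⊗[ℂ] Q :=
  { (Algebra.TensorProduct.includeRight : Q →ₐ[ℂ] P ⊗[ℂ] Q) with
    map_star' := fun x => by
      change (1 : P) ⊗ₜ[ℂ] star x = star ((1 : P) ⊗ₜ[ℂ] x)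
      rw [star_tmul, star_one] }

theorem tmulOne_apply (p : P) : tmulOne P Q p = p ⊗ₜ 1 := rfl

theorem oneTmul_apply (q : Q) : oneTmul P Q q = 1 ⊗ₜ q := rfl

theorem tmulOne_commute (p : P) (q : Q) : Commute (tmulOne P Q p) (oneTmul P Q q) := by
  rw [tmulOne_apply, oneTmul_apply, Commute, SemiconjBy, Algebra.TensorProduct.tmul_mul_tmul,
    Algebra.TensorProduct.tmul_mul_tmul, mul_one, one_mul, mul_one, one_mul]

end Algebraic

variable {A B C D : Type u} [CStarAlgebra A] [CStarAlgebra B] [CStarAlgebra C] [CStarAlgebra D]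

variable (A B C) in
/-- `a ↦ a ⊗ 1 ⊗ 1`. -/
noncomputable def leg₁ : A →⋆ₐ[ℂ] MinTensor₃ A B C :=
  (minIncl₃ A B C).comp (tmulOne A (B ⊗[ℂ] C))

variable (A B C) in
/-- `c ↦ 1 ⊗ 1 ⊗ c`. -/
noncomputable def leg₃ : C →⋆ₐ[ℂ] MinTensor₃ A B C :=
  (minIncl₃ A B C).comp ((oneTmul A (B ⊗[ℂ] C)).comp (oneTmul B C))

variable (A B C) in
/-- `y ↦ 1 ⊗ y` on the algebraic tensor product. -/
noncomputable def algLeg₂₃ : B ⊗[ℂ] C →⋆ₐ[ℂ] MinTensor₃ A B C :=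
  (minIncl₃ A B C).comp (oneTmul A (B ⊗[ℂ] C))

variable (A B C) in
/-- `a ⊗ b ↦ a ⊗ b ⊗ 1` on the algebraic tensor product. -/
noncomputable def algLeg₁₂ : A ⊗[ℂ] B →⋆ₐ[ℂ] MinTensor₃ A B C :=
  (minIncl₃ A B C).comp (starLift (tmulOne A (B ⊗[ℂ] C))
    ((oneTmul A (B ⊗[ℂ] C)).comp (tmulOne B C)) fun a b => tmulOne_commute a _)

theorem algLeg₁₂_tmul (a : A) (b : B) :
    algLeg₁₂ A B C (a ⊗ₜ b) = minIncl₃ A B C (a ⊗ₜ (b ⊗ₜ 1)) := by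
  change minIncl₃ A B C (tmulOne A (B ⊗[ℂ] C) a * oneTmul A (B ⊗[ℂ] C) (tmulOne B C b)) = _
  rw [tmulOne_apply, oneTmul_apply, tmulOne_apply, Algebra.TensorProduct.tmul_mul_tmul, mul_one,
    one_mul]

theorem algLeg₂₃_le (y : B ⊗[ℂ] C) : ‖algLeg₂₃ A B C y‖ ≤ (minSeminorm B C).toFun y := by
  refine norm_le_of_rep₃ _ _ fun r s t => ?_
  change ‖tensorHom₃ r s t (minIncl₃ A B C (1 ⊗ₜ y))‖ ≤ _
  rw [tensorHom₃_minIncl₃, repTensor_tmul, map_one]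
  refine (norm_opTensor_le _ _).trans ?_
  refine (mul_le_mul ContinuousLinearMap.norm_id_le (norm_rep_le s t y) (norm_nonneg _)
    zero_le_one).trans ?_
  rw [one_mul]

theorem norm_opTensor_one_le {H K : Type u} [NormedAddCommGroup H] [InnerProductSpace ℂ H]
    [NormedAddCommGroup K] [InnerProductSpace ℂ K] (S : H →L[ℂ] H) :
    ‖opTensor S (1 : K →L[ℂ] K)‖ ≤ ‖S‖ := by
  refine (norm_opTensor_le _ _).trans ?_
  refine (mul_le_mul_of_nonneg_left ContinuousLinearMap.norm_id_le (norm_nonneg S)).trans ?_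
  rw [mul_one]

theorem algLeg₁₂_coeff (r : StarRep A) (s : StarRep B) (t : StarRep C) (x : A ⊗[ℂ] B)
    (h h' : r.H) (k k' : s.H) (l l' : t.H) :
    inner ℂ (tensorHom₃ r s t (algLeg₁₂ A B C x) (vec h (vec k l))) (vec h' (vec k' l')) =
      inner ℂ (repTensor r.π s.π x (vec h k)) (vec h' k') * inner ℂ l l' := by
  induction x with
  | zero =>
    rw [map_zero, map_zero, map_zero]
    simp only [zero_apply, inner_zero_left, zero_mul]
  | tmul a b =>
    rw [algLeg₁₂_tmul, tensorHom₃_minIncl₃, repTensor_tmul, repTensor_tmul, repTensor_tmul,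
      map_one]
    simp only [opTensor_vec, inner_vec, one_apply_eq_self, mul_assoc]
  | add x y hx hy =>
    rw [map_add, map_add, map_add]
    simp only [add_apply, inner_add_left, hx, hy, add_mul]

theorem algLeg₁₂_le (x : A ⊗[ℂ] B) : ‖algLeg₁₂ A B C x‖ ≤ (minSeminorm A B).toFun x := by
  refine norm_le_of_rep₃ _ _ fun r s t => ?_
  refine le_trans ?_ (norm_rep_le r s x)
  refine le_trans ?_ (norm_opTensor_one_le (K := t.H) (repTensor r.π s.π x))
  refine norm_le_of_coeff _ _ (coeff_ext _ _ fun h h' k k' l l' => ?_)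
  rw [opTensor_vec, inner_vec, one_apply_eq_self]
  exact algLeg₁₂_coeff r s t x h h' k k' l l'

variable (A B C) in
/-- `t ↦ t ⊗ 1` from `A ⊗ B` to `A ⊗ B ⊗ C`. -/
noncomputable def leg₁₂ : MinTensor A B →⋆ₐ[ℂ] MinTensor₃ A B C :=
  (minSeminorm A B).lift (algLeg₁₂ A B C) algLeg₁₂_le

variable (A B C) in
/-- `t ↦ 1 ⊗ t` from `B ⊗ C` to `A ⊗ B ⊗ C`. -/
noncomputable def leg₂₃ : MinTensor B C →⋆ₐ[ℂ] MinTensor₃ A B C :=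
  (minSeminorm B C).lift (algLeg₂₃ A B C) algLeg₂₃_le

theorem leg₁₂_minIncl (x : A ⊗[ℂ] B) : leg₁₂ A B C (minIncl A B x) = algLeg₁₂ A B C x :=
  (minSeminorm A B).lift_incl _ algLeg₁₂_le x

theorem leg₂₃_minIncl (y : B ⊗[ℂ] C) : leg₂₃ A B C (minIncl B C y) = algLeg₂₃ A B C y :=
  (minSeminorm B C).lift_incl _ algLeg₂₃_le y

theorem continuous_leg₁₂ : Continuous (leg₁₂ A B C) := (minSeminorm A B).continuous_lift _ _

theorem continuous_leg₂₃ : Continuous (leg₂₃ A B C) := (minSeminorm B C).continuous_lift _ _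

theorem leg₁_commute (a : A) (t : MinTensor B C) : Commute (leg₁ A B C a) (leg₂₃ A B C t) := by
  refine (denseRange_minIncl B C).induction_on (p := fun t =>
    leg₁ A B C a * leg₂₃ A B C t = leg₂₃ A B C t * leg₁ A B C a) t
    (isClosed_eq (continuous_const.mul continuous_leg₂₃) (continuous_leg₂₃.mul continuous_const))
    fun y => ?_
  rw [leg₂₃_minIncl]
  change minIncl₃ A B C _ * minIncl₃ A B C _ = minIncl₃ A B C _ * minIncl₃ A B C _
  exact (map_mul _ _ _).symm.trans ((congrArg _ (tmulOne_commute a y)).trans (map_mul _ _ _))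

theorem leg₃_commute (t : MinTensor A B) (c : C) : Commute (leg₁₂ A B C t) (leg₃ A B C c) := by
  refine (denseRange_minIncl A B).induction_on (p := fun t =>
    leg₁₂ A B C t * leg₃ A B C c = leg₃ A B C c * leg₁₂ A B C t) t
    (isClosed_eq (continuous_leg₁₂.mul continuous_const) (continuous_const.mul continuous_leg₁₂))
    fun x => ?_
  rw [leg₁₂_minIncl]
  induction x with
  | zero => rw [map_zero, zero_mul, mul_zero]
  | tmul a b =>
    rw [algLeg₁₂_tmul]
    change minIncl₃ A B C _ * minIncl₃ A B C (1 ⊗ₜ (1 ⊗ₜ c)) =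
      minIncl₃ A B C (1 ⊗ₜ (1 ⊗ₜ c)) * minIncl₃ A B C _
    rw [← map_mul, ← map_mul]
    simp only [Algebra.TensorProduct.tmul_mul_tmul, mul_one, one_mul]
  | add x y hx hy => rw [map_add, add_mul, mul_add, hx, hy]

/-- `a ⊗ d ↦ a ⊗ f d` on the algebraic tensor product. -/
noncomputable def algIdTensor (f : D →⋆ₐ[ℂ] MinTensor B C) : A ⊗[ℂ] D →⋆ₐ[ℂ] MinTensor₃ A B C :=
  starLift (leg₁ A B C) ((leg₂₃ A B C).comp f) fun a d => leg₁_commute a (f d)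

/-- `d ⊗ c ↦ f d ⊗ c` on the algebraic tensor product. -/
noncomputable def algTensorId (f : D →⋆ₐ[ℂ] MinTensor A B) : D ⊗[ℂ] C →⋆ₐ[ℂ] MinTensor₃ A B C :=
  starLift ((leg₁₂ A B C).comp f) (leg₃ A B C) fun d c => leg₃_commute (f d) c

theorem opTensor_continuous_right {H K : Type u} [NormedAddCommGroup H] [InnerProductSpace ℂ H]
    [NormedAddCommGroup K] [InnerProductSpace ℂ K] [CompleteSpace H] [CompleteSpace K]
    (S : H →L[ℂ] H) : Continuous fun T : K →L[ℂ] K => opTensor S T :=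
  AddMonoidHomClass.continuous_of_bound (opTensorₗ S : (K →L[ℂ] K) →ₗ[ℂ] _) ‖S‖ fun T =>
    norm_opTensor_le S T

theorem tensor₃_leg₂₃ (r : StarRep A) (s : StarRep B) (t : StarRep C) (z : MinTensor B C) :
    tensorHom₃ r s t (leg₂₃ A B C z) = opTensor 1 (tensorHom s t z) := by
  refine (denseRange_minIncl B C).induction_on (p := fun z =>
    tensorHom₃ r s t (leg₂₃ A B C z) = opTensor 1 (tensorHom s t z)) z
    (isClosed_eq ((continuous_tensorHom₃ r s t).comp continuous_leg₂₃)
      ((opTensor_continuous_right 1).comp (continuous_tensorHom s t))) fun y => ?_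
  rw [leg₂₃_minIncl, tensorHom_minIncl]
  change tensorHom₃ r s t (minIncl₃ A B C (1 ⊗ₜ y)) = _
  rw [tensorHom₃_minIncl₃, repTensor_tmul, map_one]

theorem algIdTensor_le (f : D →⋆ₐ[ℂ] MinTensor B C) (x : A ⊗[ℂ] D) :
    ‖algIdTensor f x‖ ≤ (minSeminorm A D).toFun x := by
  refine norm_le_of_rep₃ _ _ fun r s t => ?_
  refine le_trans (le_of_eq ?_) (norm_rep_le r (s.tensorPullback t f) x)
  congr 1
  induction x with
  | zero => rw [map_zero, map_zero]; exact (map_zero _).symm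
  | tmul a d =>
    rw [repTensor_tmul]
    change tensorHom₃ r s t (minIncl₃ A B C (a ⊗ₜ 1) * leg₂₃ A B C (f d)) =
      opTensor (r.π a) (tensorHom s t (f d))
    rw [map_mul, tensor₃_leg₂₃, tensorHom₃_minIncl₃, repTensor_tmul, map_one]
    refine (opTensor_mul _ _ _ _).symm.trans ?_
    rw [mul_one, one_mul]
  | add x y hx hy => rw [map_add, map_add, hx, hy]; exact (map_add _ _ _).symm

/-- The matrix coefficients of `leg₁₂`. -/
theorem tensor₃_leg₁₂ (r : StarRep A) (s : StarRep B) (t : StarRep C) (z : MinTensor A B)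
    (h h' : r.H) (k k' : s.H) (l l' : t.H) :
    inner ℂ (tensorHom₃ r s t (leg₁₂ A B C z) (vec h (vec k l))) (vec h' (vec k' l')) =
      inner ℂ (tensorHom r s z (vec h k)) (vec h' k') * inner ℂ l l' := by
  refine (denseRange_minIncl A B).induction_on (p := fun z =>
    inner ℂ (tensorHom₃ r s t (leg₁₂ A B C z) (vec h (vec k l))) (vec h' (vec k' l')) =
      inner ℂ (tensorHom r s z (vec h k)) (vec h' k') * inner ℂ l l') z
    (isClosed_eq ?_ ?_) fun x => ?_
  · exact ((((continuous_tensorHom₃ r s t).comp continuous_leg₁₂).clm_apply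
      continuous_const).inner continuous_const)
  · exact (((continuous_tensorHom r s).clm_apply continuous_const).inner
      continuous_const).mul continuous_const
  · rw [leg₁₂_minIncl, tensorHom_minIncl, algLeg₁₂_coeff]

theorem tensor₃_leg₃ (r : StarRep A) (s : StarRep B) (t : StarRep C) (c : C) :
    tensorHom₃ r s t (leg₃ A B C c) = opTensor 1 (opTensor 1 (t.π c)) := by
  change tensorHom₃ r s t (minIncl₃ A B C (1 ⊗ₜ (1 ⊗ₜ c))) = _
  rw [tensorHom₃_minIncl₃, repTensor_tmul, repTensor_tmul, map_one, map_one]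

theorem algTensorId_le (f : D →⋆ₐ[ℂ] MinTensor A B) (x : D ⊗[ℂ] C) :
    ‖algTensorId f x‖ ≤ (minSeminorm D C).toFun x := by
  refine norm_le_of_rep₃ _ _ fun r s t => ?_
  refine le_trans ?_ (norm_rep_le (r.tensorPullback s f) t x)
  let T : HilbertTensor (HilbertTensor r.H s.H) t.H →L[ℂ]
      HilbertTensor (HilbertTensor r.H s.H) t.H := repTensor ((tensorHom r s).comp f) t.π x
  refine norm_le_of_coeff _ T (coeff_ext _ _ fun h h' k k' l l' => ?_)
  change _ = inner ℂ (repTensor ((tensorHom r s).comp f) t.π x _) _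
  induction x with
  | zero =>
    rw [map_zero, map_zero, map_zero]
    simp only [zero_apply, inner_zero_left]
  | tmul d c =>
    rw [repTensor_tmul]
    change inner ℂ (tensorHom₃ r s t (leg₁₂ A B C (f d) * leg₃ A B C c) _) _ = _
    rw [map_mul, tensor₃_leg₃, mul_apply_eq_comp, opTensor_vec, opTensor_vec, tensor₃_leg₁₂,
      opTensor_vec, inner_vec, one_apply_eq_self, one_apply_eq_self]
    rfl
  | add x y hx hy =>
    rw [map_add, map_add, map_add]
    simp only [add_apply, inner_add_left, hx, hy]

/-- `id ⊗ f : A ⊗ D → A ⊗ B ⊗ C` for a ⋆-homomorphism `f : D → B ⊗ C`. -/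
noncomputable def idTensor (f : D →⋆ₐ[ℂ] MinTensor B C) : MinTensor A D →⋆ₐ[ℂ] MinTensor₃ A B C :=
  (minSeminorm A D).lift (algIdTensor f) (algIdTensor_le f)

/-- `f ⊗ id : D ⊗ C → A ⊗ B ⊗ C` for a ⋆-homomorphism `f : D → A ⊗ B`. -/
noncomputable def tensorId (f : D →⋆ₐ[ℂ] MinTensor A B) : MinTensor D C →⋆ₐ[ℂ] MinTensor₃ A B C :=
  (minSeminorm D C).lift (algTensorId f) (algTensorId_le f)

theorem idTensor_minTmul (f : D →⋆ₐ[ℂ] MinTensor B C) (a : A) (d : D) :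
    idTensor f (minTmul a d) = leg₁ A B C a * leg₂₃ A B C (f d) :=
  (minSeminorm A D).lift_incl _ (algIdTensor_le f) (a ⊗ₜ d)

theorem tensorId_minTmul (f : D →⋆ₐ[ℂ] MinTensor A B) (d : D) (c : C) :
    tensorId f (minTmul d c) = leg₁₂ A B C (f d) * leg₃ A B C c :=
  (minSeminorm D C).lift_incl _ (algTensorId_le f) (d ⊗ₜ c)

end Amplification

/-! ### Compact quantum groups, co-actions and co-representations -/

/-- A compact quantum group structure on a unital C⋆-algebra. -/
structure CompactQuantumGroup (A : Type u) [CStarAlgebra A] where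
  /-- the co-product `Δ` -/
  comul : A →⋆ₐ[ℂ] MinTensor A A
  /-- `(Δ ⊗ id) Δ = (id ⊗ Δ) Δ` -/
  coassoc : ∀ a, tensorId comul (comul a) = idTensor comul (comul a)
  /-- `Δ(A)(1 ⊗ A)` spans a dense subspace of `A ⊗ A` -/
  dense_right : Dense (Submodule.span ℂ {z : MinTensor A A | ∃ a b, z = comul a * minTmul 1 b} :
    Set (MinTensor A A))
  /-- `Δ(A)(A ⊗ 1)` spans a dense subspace of `A ⊗ A` -/
  dense_left : Dense (Submodule.span ℂ {z : MinTensor A A | ∃ a b, z = comul a * minTmul b 1} :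
    Set (MinTensor A A))

section Coaction

variable {A : Type u} [CStarAlgebra A]

/-!
For a finite set `X`, the vector space `X → ℂ` has the basis `χ_x = Pi.single x 1`. It is used both
as the C⋆-algebra `C(X)` and as the Hilbert space `L²(X)` with orthonormal basis `χ_x`. The tensor
product of `X → ℂ` with a C⋆-algebra `B` is `X → B`, the element `f ⊗ b` being the function
`x ↦ f x • b`; its topology is the product topology. In the same way, `B(L²(X)) ⊗ B` is the algebra
of `X × X` matrices over `B`.
-/

variable {X : Type v} [Fintype X] [DecidableEq X]

/-- The map `γ ⊗ id` from `(X → ℂ) ⊗ A` to `(X → ℂ) ⊗ A ⊗ A`, for a linear map `γ` from `X → ℂ`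
to `(X → ℂ) ⊗ A`: it sends `χ_y ⊗ a` to `γ(χ_y) ⊗ a`. -/
noncomputable def ampId (γ : (X → ℂ) →ₗ[ℂ] (X → A)) (F : X → A) : X → MinTensor A A :=
  fun x => ∑ y, minTmul (γ (Pi.single y 1) x) (F y)

/-- The map `id ⊗ Δ` from `(X → ℂ) ⊗ A` to `(X → ℂ) ⊗ A ⊗ A`. -/
noncomputable def idAmp (Q : CompactQuantumGroup A) (F : X → A) : X → MinTensor A A :=
  fun x => Q.comul (F x)

/-- A linear map `α : C(X) → C(X) ⊗ A` is a co-action of the compact quantum group on the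
C⋆-algebra `C(X)`. -/
structure IsCoaction (Q : CompactQuantumGroup A) (α : (X → ℂ) →ₗ[ℂ] (X → A)) : Prop where
  map_one : α 1 = 1
  map_mul : ∀ f g, α (f * g) = α f * α g
  map_star : ∀ f, α (star f) = star (α f)
  /-- `(α ⊗ id) α = (id ⊗ Δ) α` -/
  coassoc : ∀ f, ampId α (α f) = idAmp Q (α f)
  /-- `α(C(X))(1 ⊗ A)` spans a dense subspace of `C(X) ⊗ A` -/
  dense : Dense (Submodule.span ℂ {F : X → A | ∃ f a, F = fun x => α f x * a} : Set (X → A))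

/-- The matrix `U` of a linear map `β : L²(X) → L²(X) ⊗ A`, determined by
`β(χ_τ) = ∑_σ χ_σ ⊗ U_{στ}`. -/
noncomputable def corepMatrix (β : (X → ℂ) →ₗ[ℂ] (X → A)) : Matrix X X A :=
  Matrix.of fun σ τ => β (Pi.single τ 1) σ

/-- `β : L²(X) → L²(X) ⊗ A` is a bi-unitary co-representation: its matrix `U` satisfies
`Δ(U_{στ}) = ∑_ρ U_{σρ} ⊗ U_{ρτ}`, and both `U` and the entrywise adjoint of `U` are unitary. -/
structure IsBiunitaryCorep (Q : CompactQuantumGroup A) (β : (X → ℂ) →ₗ[ℂ] (X → A)) : Prop where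
  comul_matrix : ∀ σ τ, Q.comul (corepMatrix β σ τ) =
    ∑ ρ, minTmul (corepMatrix β σ ρ) (corepMatrix β ρ τ)
  unitary_matrix : corepMatrix β ∈ unitary (Matrix X X A)
  unitary_conj : (corepMatrix β).map star ∈ unitary (Matrix X X A)

/-- `T ↦ U (T ⊗ 1) U^*`, from `B(L²(X))` to `B(L²(X)) ⊗ A`. -/
noncomputable def conjAd (U : Matrix X X A) (T : Matrix X X ℂ) : Matrix X X A :=
  U * T.map (algebraMap ℂ A) * U.conjTranspose

theorem conjAd_add (U : Matrix X X A) (S T : Matrix X X ℂ) :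
    conjAd U (S + T) = conjAd U S + conjAd U T := by
  rw [conjAd, conjAd, conjAd, Matrix.map_add _ (fun _ _ => map_add _ _ _), mul_add, add_mul]

theorem conjAd_smul (U : Matrix X X A) (c : ℂ) (T : Matrix X X ℂ) :
    conjAd U (c • T) = c • conjAd U T := by
  have h : (c • T).map (algebraMap ℂ A) = c • T.map (algebraMap ℂ A) := by
    ext i j
    simp [Algebra.algebraMap_eq_smul_one, smul_smul]
  rw [conjAd, conjAd, h, Matrix.mul_smul, Matrix.smul_mul]

end Coaction

/-! ### Multigraphs and quantum symmetry in the sense of Banica -/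

/-- A directed multigraph with vertex set `V` and edge set `E`. -/
structure Multigraph (V : Type v) (E : Type w) where
  /-- source map -/
  s : E → V
  /-- target map -/
  t : E → V

namespace Multigraph

variable {A : Type u} [CStarAlgebra A] {V : Type v} {E : Type w}
variable (G : Multigraph V E)

/-- No vertex is isolated: every vertex is the source or the target of some edge. -/
def NoIsolated : Prop := ∀ v, v ∈ Set.range G.s ∨ v ∈ Set.range G.t

/-- The set `V^s` of sources of edges. -/
abbrev Vs : Type v := {v : V // v ∈ Set.range G.s}

/-- The set `V^t` of targets of edges. -/
abbrev Vt : Type v := {v : V // v ∈ Set.range G.t}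

variable [DecidableEq E]

/-- The map `S ⊗ id_R : C(V^s) ⊗ R → B(L²(E)) ⊗ R`, where `S(χ_v)` is the projection onto the span
of the edges with source `v`. For `R = ℂ` this is `S` itself. -/
def sourceDiag {R : Type*} [Zero R] (F : G.Vs → R) : Matrix E E R :=
  Matrix.diagonal fun σ => F ⟨G.s σ, σ, rfl⟩

/-- The map `T ⊗ id_R : C(V^t) ⊗ R → B(L²(E)) ⊗ R`, where `T(χ_w)` is the projection onto the span
of the edges with target `w`. For `R = ℂ` this is `T` itself. -/
def targetDiag {R : Type*} [Zero R] (F : G.Vt → R) : Matrix E E R :=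
  Matrix.diagonal fun σ => F ⟨G.t σ, σ, rfl⟩

variable [Fintype E]

/-- `Ad_β(S(f))` -/
noncomputable def adSource (β : (E → ℂ) →ₗ[ℂ] (E → A)) (f : G.Vs → ℂ) : Matrix E E A :=
  conjAd (corepMatrix β) (G.sourceDiag f)

/-- `Ad_β̄(T(f))`, where the matrix of `β̄` is the entrywise adjoint of the matrix of `β` -/
noncomputable def adTarget (β : (E → ℂ) →ₗ[ℂ] (E → A)) (f : G.Vt → ℂ) : Matrix E E A :=
  conjAd ((corepMatrix β).map star) (G.targetDiag f)

/-- The induced map `α_s : C(V^s) → C(V^s) ⊗ A`, determined by `(S ⊗ id)(α_s(f)) = Ad_β(S(f))` when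
`Ad_β` maps `S(C(V^s))` into `S(C(V^s)) ⊗ A` (see `sourceDiag_inducedSource`): the coefficient of
`α_s(f)` at `v` is the diagonal entry of `Ad_β(S(f))` at an edge with source `v`. -/
noncomputable def inducedSource (β : (E → ℂ) →ₗ[ℂ] (E → A)) : (G.Vs → ℂ) →ₗ[ℂ] (G.Vs → A) where
  toFun f := fun v => G.adSource β f v.2.choose v.2.choose
  map_add' f g := by
    have h : G.sourceDiag (f + g) = G.sourceDiag f + G.sourceDiag g :=
      (Matrix.diagonal_add _ _).symm
    funext v
    rw [adSource, h, conjAd_add]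
    rfl
  map_smul' c f := by
    have h : G.sourceDiag (c • f) = c • G.sourceDiag f := Matrix.diagonal_smul c _
    funext v
    rw [adSource, h, conjAd_smul]
    rfl

/-- The induced map `α_t : C(V^t) → C(V^t) ⊗ A`, determined by `(T ⊗ id)(α_t(f)) = Ad_β̄(T(f))` when
`Ad_β̄` maps `T(C(V^t))` into `T(C(V^t)) ⊗ A` (see `targetDiag_inducedTarget`). -/
noncomputable def inducedTarget (β : (E → ℂ) →ₗ[ℂ] (E → A)) : (G.Vt → ℂ) →ₗ[ℂ] (G.Vt → A) where
  toFun f := fun v => G.adTarget β f v.2.choose v.2.choose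
  map_add' f g := by
    have h : G.targetDiag (f + g) = G.targetDiag f + G.targetDiag g :=
      (Matrix.diagonal_add _ _).symm
    funext v
    rw [adTarget, h, conjAd_add]
    rfl
  map_smul' c f := by
    have h : G.targetDiag (c • f) = c • G.targetDiag f := Matrix.diagonal_smul c _
    funext v
    rw [adTarget, h, conjAd_smul]
    rfl

theorem sourceDiag_inducedSource (β : (E → ℂ) →ₗ[ℂ] (E → A)) (f : G.Vs → ℂ)
    (h : ∃ F : G.Vs → A, G.adSource β f = G.sourceDiag F) :
    G.sourceDiag (G.inducedSource β f) = G.adSource β f := by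
  obtain ⟨F, hF⟩ := h
  have h1 : G.inducedSource β f = F := by
    funext v
    change G.adSource β f v.2.choose v.2.choose = F v
    rw [hF, sourceDiag, Matrix.diagonal_apply_eq]
    exact congrArg F (Subtype.ext v.2.choose_spec)
  rw [h1, hF]

theorem targetDiag_inducedTarget (β : (E → ℂ) →ₗ[ℂ] (E → A)) (f : G.Vt → ℂ)
    (h : ∃ F : G.Vt → A, G.adTarget β f = G.targetDiag F) :
    G.targetDiag (G.inducedTarget β f) = G.adTarget β f := by
  obtain ⟨F, hF⟩ := h
  have h1 : G.inducedTarget β f = F := by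
    funext v
    change G.adTarget β f v.2.choose v.2.choose = F v
    rw [hF, targetDiag, Matrix.diagonal_apply_eq]
    exact congrArg F (Subtype.ext v.2.choose_spec)
  rw [h1, hF]

/-- `β` is a co-action of the compact quantum group on the multigraph which preserves its quantum
symmetry in the sense of Banica. -/
structure IsBanicaCoaction (Q : CompactQuantumGroup A) (β : (E → ℂ) →ₗ[ℂ] (E → A)) : Prop where
  corep : IsBiunitaryCorep Q β
  /-- `Ad_β(S(C(V^s))) ⊆ S(C(V^s)) ⊗ A` -/
  source : ∀ f : G.Vs → ℂ, ∃ F : G.Vs → A, G.adSource β f = G.sourceDiag F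
  /-- `Ad_β̄(T(C(V^t))) ⊆ T(C(V^t)) ⊗ A` -/
  target : ∀ f : G.Vt → ℂ, ∃ F : G.Vt → A, G.adTarget β f = G.targetDiag F
  /-- `α_s` preserves `C(V^s ∩ V^t)` -/
  source_inter : ∀ f : G.Vs → ℂ, (∀ v, v.1 ∉ Set.range G.t → f v = 0) →
    ∀ v, v.1 ∉ Set.range G.t → G.inducedSource β f v = 0
  /-- `α_t` preserves `C(V^s ∩ V^t)` -/
  target_inter : ∀ f : G.Vt → ℂ, (∀ v, v.1 ∉ Set.range G.s → f v = 0) →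
    ∀ v, v.1 ∉ Set.range G.s → G.inducedTarget β f v = 0
  /-- `α_s` and `α_t` agree on `C(V^s ∩ V^t)` -/
  agree : ∀ f : V → ℂ, (∀ v, ¬ (v ∈ Set.range G.s ∧ v ∈ Set.range G.t) → f v = 0) →
    ∀ (v : V) (hs : v ∈ Set.range G.s) (ht : v ∈ Set.range G.t),
      G.inducedSource β (fun w => f w.1) ⟨v, hs⟩ = G.inducedTarget β (fun w => f w.1) ⟨v, ht⟩
  /-- `β` fixes `ξ₀ = ∑_τ χ_τ` -/
  fix : β (fun _ => 1) = fun _ => 1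

variable [Fintype V] [DecidableEq V]

open Classical in
/-- The coefficient at `v` of the image of `χ_k` under the induced map on `C(V)`: that of
`α_s(χ_k)` if `k ∈ V^s`, and that of `α_t(χ_k)` if `k ∈ V^t ∖ V^s`, functions on `V^s` and on `V^t`
being extended by zero to `V`. -/
noncomputable def inducedCoeff (β : (E → ℂ) →ₗ[ℂ] (E → A)) (k v : V) : A :=
  if hk : k ∈ Set.range G.s then
    if hv : v ∈ Set.range G.s then G.inducedSource β (Pi.single ⟨k, hk⟩ 1) ⟨v, hv⟩ else 0
  else if hk : k ∈ Set.range G.t then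
    if hv : v ∈ Set.range G.t then G.inducedTarget β (Pi.single ⟨k, hk⟩ 1) ⟨v, hv⟩ else 0
  else 0

/-- The induced map `α : C(V) → C(V) ⊗ A` with `α(χ_k) = α_s(χ_k)` for `k ∈ V^s` and
`α(χ_k) = α_t(χ_k)` for `k ∈ V^t`. -/
noncomputable def inducedVertex (β : (E → ℂ) →ₗ[ℂ] (E → A)) : (V → ℂ) →ₗ[ℂ] (V → A) where
  toFun f := fun v => ∑ k, f k • G.inducedCoeff β k v
  map_add' f g := by
    funext v
    simp only [Pi.add_apply, add_smul, Finset.sum_add_distrib]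
  map_smul' c f := by
    funext v
    simp only [Pi.smul_apply, smul_eq_mul, mul_smul, Finset.smul_sum, RingHom.id_apply]

theorem inducedVertex_single (β : (E → ℂ) →ₗ[ℂ] (E → A)) (k : V) :
    G.inducedVertex β (Pi.single k 1) = G.inducedCoeff β k := by
  funext v
  change ∑ j, (Pi.single k 1 : V → ℂ) j • G.inducedCoeff β j v = _
  rw [Finset.sum_eq_single k]
  · rw [Pi.single_eq_same, one_smul]
  · intro j _ hj
    rw [Pi.single_eq_of_ne hj, zero_smul]
  · intro h
    exact absurd (Finset.mem_univ k) h

open Classical in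
theorem inducedVertex_of_source (β : (E → ℂ) →ₗ[ℂ] (E → A)) (k : V) (hk : k ∈ Set.range G.s) :
    G.inducedVertex β (Pi.single k 1) = fun v =>
      if hv : v ∈ Set.range G.s then G.inducedSource β (Pi.single ⟨k, hk⟩ 1) ⟨v, hv⟩ else 0 := by
  rw [inducedVertex_single]
  funext v
  rw [inducedCoeff, dif_pos hk]

open Classical in
theorem inducedVertex_of_target {Q : CompactQuantumGroup A} {β : (E → ℂ) →ₗ[ℂ] (E → A)}
    (h : G.IsBanicaCoaction Q β) (k : V) (hk : k ∈ Set.range G.t) :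
    G.inducedVertex β (Pi.single k 1) = fun v =>
      if hv : v ∈ Set.range G.t then G.inducedTarget β (Pi.single ⟨k, hk⟩ 1) ⟨v, hv⟩ else 0 := by
  by_cases hs : k ∈ Set.range G.s
  · have e1 : (Pi.single ⟨k, hs⟩ 1 : G.Vs → ℂ) = fun w => (Pi.single k 1 : V → ℂ) w.1 := by
      funext w
      simp only [Pi.single_apply, Subtype.ext_iff]
    have e2 : (Pi.single ⟨k, hk⟩ 1 : G.Vt → ℂ) = fun w => (Pi.single k 1 : V → ℂ) w.1 := by
      funext w
      simp only [Pi.single_apply, Subtype.ext_iff]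
    have e3 : ∀ v : V, v ≠ k → (Pi.single k 1 : V → ℂ) v = 0 := fun v hv =>
      Pi.single_eq_of_ne hv 1
    rw [inducedVertex_of_source G β k hs]
    funext v
    by_cases hvs : v ∈ Set.range G.s <;> by_cases hvt : v ∈ Set.range G.t
    · rw [dif_pos hvs, dif_pos hvt, e1, e2]
      exact h.agree _ (fun v hv => e3 v fun hvk => hv (hvk ▸ ⟨hs, hk⟩)) v hvs hvt
    · rw [dif_pos hvs, dif_neg hvt, e1]
      exact h.source_inter _ (fun v hv => e3 v.1 fun hvk => hv (hvk ▸ hk)) ⟨v, hvs⟩ hvt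
    · rw [dif_neg hvs, dif_pos hvt, e2]
      exact (h.target_inter _ (fun v hv => e3 v.1 fun hvk => hv (hvk ▸ hs)) ⟨v, hvt⟩ hvs).symm
    · rw [dif_neg hvs, dif_neg hvt]
  · rw [inducedVertex_single]
    funext v
    rw [inducedCoeff, dif_neg hs, dif_pos hk]

end Multigraph

/-! ### Co-actions on C⋆-correspondences -/

open scoped ComplexOrder in
/-- A C⋆-correspondence over the finite-dimensional commutative C⋆-algebra `C(V) = (V → ℂ)` whose
underlying vector space is `E → ℂ`: a right Hilbert `C(V)`-module with a ⋆-homomorphism `φ` of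
`C(V)` into its adjointable operators. -/
structure FiniteCorrespondence (V : Type v) (E : Type w) where
  /-- the right action `ξ · f` -/
  rsmul : (E → ℂ) →ₗ[ℂ] (V → ℂ) →ₗ[ℂ] (E → ℂ)
  rsmul_one : ∀ ξ, rsmul ξ 1 = ξ
  rsmul_mul : ∀ ξ f g, rsmul ξ (f * g) = rsmul (rsmul ξ f) g
  /-- the `C(V)`-valued inner product, linear in the second variable -/
  ip : (E → ℂ) →ₗ⋆[ℂ] (E → ℂ) →ₗ[ℂ] (V → ℂ)
  ip_rsmul : ∀ ξ η f, ip ξ (rsmul η f) = ip ξ η * f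
  star_ip : ∀ ξ η, star (ip ξ η) = ip η ξ
  ip_self_nonneg : ∀ ξ v, 0 ≤ ip ξ ξ v
  ip_self_eq_zero : ∀ ξ, ip ξ ξ = 0 → ξ = 0
  /-- the left action -/
  φ : (V → ℂ) →ₙₐ[ℂ] Module.End ℂ (E → ℂ)
  /-- `φ(f)` is adjointable, with adjoint `φ(f^*)` -/
  ip_φ : ∀ f ξ η, ip (φ f ξ) η = ip ξ (φ (star f) η)

section Correspondence

variable {A : Type u} [CStarAlgebra A] {V : Type v} {E : Type w}
variable [Fintype V] [DecidableEq V] [Fintype E] [DecidableEq E]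

/-- The `C(V) ⊗ A`-valued inner product on `X ⊗ A`, determined by
`⟨ξ ⊗ a, η ⊗ b⟩ = ⟨ξ, η⟩ ⊗ a^* b`. -/
noncomputable def FiniteCorrespondence.ipAmp (X : FiniteCorrespondence V E) (x y : E → A) : V → A :=
  fun v => ∑ σ, ∑ τ, X.ip (Pi.single σ 1) (Pi.single τ 1) v • (star (x σ) * y τ)

/-- The action `φ ⊗ id` of `C(V) ⊗ A` on `X ⊗ A`, determined by
`(φ ⊗ id)(f ⊗ a)(ξ ⊗ b) = φ(f) ξ ⊗ a b`. -/
noncomputable def FiniteCorrespondence.φAmp (X : FiniteCorrespondence V E) (F : V → A) (x : E → A) :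
    E → A :=
  fun σ => ∑ i, ∑ τ, X.φ (Pi.single i 1) (Pi.single τ 1) σ • (F i * x τ)

/-- The pair `(β, α)` is a co-action of the compact quantum group on the C⋆-correspondence `X` over
`C(V)`. -/
structure IsCorrespondenceCoaction (Q : CompactQuantumGroup A) (X : FiniteCorrespondence V E)
    (β : (E → ℂ) →ₗ[ℂ] (E → A)) (α : (V → ℂ) →ₗ[ℂ] (V → A)) : Prop where
  /-- `α` is a co-action on the C⋆-algebra `C(V)` -/
  coaction : IsCoaction Q α
  /-- `(β ⊗ id) β = (id ⊗ Δ) β` -/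
  coassoc : ∀ ξ, ampId β (β ξ) = idAmp Q (β ξ)
  /-- `β(X)(1 ⊗ A)` spans a dense subspace of `X ⊗ A` -/
  dense : Dense (Submodule.span ℂ {x : E → A | ∃ ξ a, x = fun σ => β ξ σ * a} : Set (E → A))
  /-- `β(φ(f) ξ) = (φ ⊗ id)(α(f)) β(ξ)` -/
  left_equivariant : ∀ f ξ, β (X.φ f ξ) = X.φAmp (α f) (β ξ)
  /-- `⟨β(ξ), β(η)⟩ = α(⟨ξ, η⟩)` -/
  ip_preserving : ∀ ξ η, X.ipAmp (β ξ) (β η) = α (X.ip ξ η)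

open scoped ComplexOrder in
/-- The C⋆-correspondence `(L²(E), φ)` over `C(V)` of a finite directed multigraph:
`χ_τ · f = f(t(τ)) χ_τ`, `⟨χ_σ, χ_τ⟩ = δ_{σ,τ} χ_{t(σ)}` and `φ(f) χ_σ = f(s(σ)) χ_σ`. -/
noncomputable def Multigraph.correspondence (G : Multigraph V E) : FiniteCorrespondence V E where
  rsmul := LinearMap.mk₂ ℂ (fun ξ f σ => ξ σ * f (G.t σ))
    (fun ξ η f => by funext σ; exact add_mul _ _ _)
    (fun c ξ f => by funext σ; exact mul_assoc _ _ _)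
    (fun ξ f g => by funext σ; exact mul_add _ _ _)
    (fun c ξ f => by funext σ; exact mul_left_comm _ _ _)
  rsmul_one ξ := by funext σ; exact mul_one _
  rsmul_mul ξ f g := by funext σ; exact (mul_assoc _ _ _).symm
  ip := LinearMap.mk₂'ₛₗ (starRingEnd ℂ) (RingHom.id ℂ)
    (fun ξ η v => ∑ σ, if G.t σ = v then star (ξ σ) * η σ else 0)
    (fun ξ ξ' η => by
      funext v
      rw [Pi.add_apply, ← Finset.sum_add_distrib]
      refine Finset.sum_congr rfl fun σ _ => ?_
      split_ifs
      · rw [Pi.add_apply, star_add, add_mul]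
      · rw [add_zero])
    (fun c ξ η => by
      funext v
      rw [Pi.smul_apply, Finset.smul_sum]
      refine Finset.sum_congr rfl fun σ _ => ?_
      split_ifs
      · rw [Pi.smul_apply, smul_eq_mul, smul_eq_mul, star_mul', mul_assoc]; rfl
      · rw [smul_zero])
    (fun ξ η η' => by
      funext v
      rw [Pi.add_apply, ← Finset.sum_add_distrib]
      refine Finset.sum_congr rfl fun σ _ => ?_
      split_ifs
      · rw [Pi.add_apply, mul_add]
      · rw [add_zero])
    (fun c ξ η => by
      funext v
      rw [Pi.smul_apply, Finset.smul_sum]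
      refine Finset.sum_congr rfl fun σ _ => ?_
      split_ifs
      · rw [Pi.smul_apply, smul_eq_mul, RingHom.id_apply, smul_eq_mul, mul_left_comm]
      · rw [smul_zero])
  ip_rsmul ξ η f := by
    funext v
    simp only [LinearMap.mk₂'ₛₗ_apply, LinearMap.mk₂_apply, Pi.mul_apply, Finset.sum_mul]
    refine Finset.sum_congr rfl fun σ _ => ?_
    split_ifs with h
    · rw [h, mul_assoc]
    · rw [zero_mul]
  star_ip ξ η := by
    funext v
    simp only [LinearMap.mk₂'ₛₗ_apply, Pi.star_apply, star_sum]
    refine Finset.sum_congr rfl fun σ _ => ?_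
    split_ifs
    · rw [star_mul', star_star, mul_comm]
    · rw [star_zero]
  ip_self_nonneg ξ v := by
    simp only [LinearMap.mk₂'ₛₗ_apply]
    refine Finset.sum_nonneg fun σ _ => ?_
    split_ifs
    · exact star_mul_self_nonneg _
    · exact le_rfl
  ip_self_eq_zero ξ h := by
    funext σ
    have h1 := congrFun h (G.t σ)
    simp only [LinearMap.mk₂'ₛₗ_apply, Pi.zero_apply] at h1
    rw [Finset.sum_eq_zero_iff_of_nonneg] at h1
    · have h2 := h1 σ (Finset.mem_univ σ)
      rw [if_pos rfl] at h2
      exact (CStarRing.star_mul_self_eq_zero_iff (ξ σ)).mp h2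
    · intro τ _
      split_ifs
      · exact star_mul_self_nonneg _
      · exact le_rfl
  φ :=
    { toFun := fun f =>
        { toFun := fun ξ σ => f (G.s σ) * ξ σ
          map_add' := fun ξ η => by funext σ; exact mul_add _ _ _
          map_smul' := fun c ξ => by funext σ; exact mul_left_comm _ _ _ }
      map_smul' := fun c f => by
        refine LinearMap.ext fun ξ => ?_
        funext σ; exact mul_assoc _ _ _
      map_zero' := by
        refine LinearMap.ext fun ξ => ?_
        funext σ; exact zero_mul _
      map_add' := fun f g => by
        refine LinearMap.ext fun ξ => ?_
        funext σ; exact add_mul _ _ _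
      map_mul' := fun f g => by
        refine LinearMap.ext fun ξ => ?_
        funext σ; exact mul_assoc _ _ _ }
  ip_φ f ξ η := by
    funext v
    simp only [LinearMap.mk₂'ₛₗ_apply]
    refine Finset.sum_congr rfl fun σ _ => ?_
    split_ifs
    · change star (f (G.s σ) * ξ σ) * η σ = star (ξ σ) * (star (f (G.s σ)) * η σ)
      rw [star_mul', mul_comm (star (f (G.s σ))), mul_assoc]
    · rfl

end Correspondence

/-! Write `q v k` for the coefficient of `α(χ_k)` at `v`, that is `G.inducedCoeff β k v`. Everything
reduces to showing that `q` is a magic unitary (projections, with all rows and columns summing to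
`1`) that is compatible with `U` along `s` and with `Ū` along `t`.

Both compatibilities are instances of one structure, `IsDiagonalNormalizer`: a matrix `W` that fixes
the constant vector and conjugates the fibre projections of a map `r` into diagonal matrices with
entries `p (r σ) k`. Multiplying the conjugation relation by `W` on the right gives `p (r σ) k * W σ
τ = [r τ = k] W σ τ` (`coeff_mul`), and applying it to the constant vector gives `p (r σ) k = ∑_{r τ
= k} W σ τ` (`coeff_eq_sum`). Hence each row of `p` at a value of `r` consists of orthogonal
projections with sum `1`.

Two points need positivity. Since `α_s` only sees `V^s` and `α_t` only sees `V^t`, the matrix `q`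
must be shown to vanish between `V^s` and its complement in both directions, and likewise for `V^t`;
one direction is in the definitions and hypotheses, the other follows by counting edges
(`coeff_eq_zero_of_invariant`). Columns are harder, because fibres of different sizes prevent
reading column sums of `q` off those of `W`. Instead, `q v (r τ)` dominates the part over `v` of the
`τ`-th column of `W`, so every column sum is at least `1` (`one_le_sum_coeff`); as the row sums are
`1` and `q` is square, equality holds (`col_sum_inducedCoeff`). Projections summing to `1` are
orthogonal, so the columns of `q` are orthogonal too.

The conditions now follow: the co-product of `q` comes from that of `U` by summing over fibres,
density from the right inverses `qᵀ` and `U^*`, left equivariance is `coeff_mul` for `s`, and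
preservation of the inner product is `sum_fiber` for `t`. -/

/-! ### Projections in C⋆-algebras summing to one -/

/-- Projections of a C⋆-algebra with sum `1` are pairwise orthogonal. -/
theorem mul_eq_zero_of_sum_eq_one {A : Type u} [CStarAlgebra A] [PartialOrder A]
    [StarOrderedRing A] {ι : Type v} [Fintype ι] {p : ι → A} (hs : ∀ i, star (p i) = p i)
    (hm : ∀ i, p i * p i = p i) (h1 : ∑ i, p i = 1) {i j : ι} (hij : i ≠ j) : p i * p j = 0 := by
  classical
  -- Compressing `∑ p k = 1` by `p j` gives `∑ p j * p k * p j = p j`. The term `k = j` already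
  -- accounts for the right side, so the remaining terms are positive with sum zero.
  have h2 : ∑ k ∈ Finset.univ.erase j, star (p k * p j) * (p k * p j) = 0 := by
    have h3 : ∀ k, star (p k * p j) * (p k * p j) = p j * p k * p j := fun k => by
      rw [star_mul, hs, hs, ← mul_assoc, mul_assoc (p j) (p k) (p k), hm]
    have h4 := Finset.add_sum_erase Finset.univ
      (fun k => star (p k * p j) * (p k * p j)) (Finset.mem_univ j)
    have h5 : ∑ k, star (p k * p j) * (p k * p j) = p j := by
      simp only [h3]
      rw [← Finset.sum_mul, ← Finset.mul_sum, h1, mul_one, hm]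
    rw [h5] at h4
    rw [h3 j, hm, hm] at h4
    exact left_eq_add.mp h4.symm
  rw [Finset.sum_eq_zero_iff_of_nonneg fun k _ => star_mul_self_nonneg _] at h2
  exact (CStarRing.star_mul_self_eq_zero_iff _).mp
    (h2 i (Finset.mem_erase.mpr ⟨hij, Finset.mem_univ i⟩))

/-! ### Unitary matrices normalizing a diagonal subalgebra -/

/-- A matrix `W` over `A`, unitary together with its entrywise adjoint and fixing the constant
vector, such that conjugation by `W` maps the indicator function of `{τ | r τ = k}`, as a diagonal
matrix, to the diagonal matrix with entries `p (r σ) k`. -/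
structure IsDiagonalNormalizer {A : Type u} [CStarAlgebra A] {V : Type v} {E : Type w} [Fintype E]
    [DecidableEq E] [DecidableEq V] (W : E → E → A) (r : E → V) (p : V → V → A) : Prop where
  row_sum : ∀ σ, ∑ τ, W σ τ = 1
  col_star_mul : ∀ τ τ', ∑ σ, star (W σ τ) * W σ τ' = if τ = τ' then 1 else 0
  col_mul_star : ∀ τ τ', ∑ σ, W σ τ * star (W σ τ') = if τ = τ' then 1 else 0
  coeff : ∀ σ σ' k, (∑ τ, if r τ = k then W σ τ * star (W σ' τ) else 0) =
    if σ = σ' then p (r σ) k else 0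

namespace IsDiagonalNormalizer

variable {A : Type u} [CStarAlgebra A] {V : Type v} {E : Type w} [Fintype E]
  [DecidableEq E] [DecidableEq V] {W : E → E → A} {r : E → V} {p : V → V → A}

/-- An isometry that fixes a vector has an adjoint that fixes it as well: `W^* ξ₀ = W^* W ξ₀ = ξ₀`.
-/
theorem sum_star (h : IsDiagonalNormalizer W r p) (τ : E) : ∑ σ, star (W σ τ) = 1 := by
  calc ∑ σ, star (W σ τ) = ∑ σ, star (W σ τ) * ∑ τ', W σ τ' := by simp only [h.row_sum, mul_one]
    _ = ∑ τ', ∑ σ, star (W σ τ) * W σ τ' := by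
      simp only [Finset.mul_sum]
      exact Finset.sum_comm
    _ = 1 := by simp [h.col_star_mul]

theorem col_sum (h : IsDiagonalNormalizer W r p) (τ : E) : ∑ σ, W σ τ = 1 := by
  have h1 := congrArg star (h.sum_star τ)
  simpa using h1

/-- The conjugated projection is applied to the constant vector: `W^*` fixes it, the projection
turns it into the indicator of a fibre, and `W` sums over that fibre. Thus the coefficients are
linear in `W`, which is what makes the co-product computable on them. -/
theorem coeff_eq_sum (h : IsDiagonalNormalizer W r p) (σ : E) (k : V) :
    p (r σ) k = ∑ τ, if r τ = k then W σ τ else 0 := by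
  have h1 : ∑ σ', (if σ = σ' then p (r σ) k else 0) = p (r σ) k := by simp
  rw [← h1, Finset.sum_congr rfl fun σ' _ => (h.coeff σ σ' k).symm, Finset.sum_comm]
  refine Finset.sum_congr rfl fun τ _ => ?_
  split_ifs
  · rw [← Finset.mul_sum, h.sum_star, mul_one]
  · exact Finset.sum_const_zero

/-- This is `(W D W^*) W = W D` in coordinates, with `D` the projection onto the fibre over `k`. -/
theorem coeff_mul (h : IsDiagonalNormalizer W r p) (σ τ : E) (k : V) :
    p (r σ) k * W σ τ = if r τ = k then W σ τ else 0 := by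
  have h1 : ∑ σ', (if σ = σ' then p (r σ) k else 0) * W σ' τ = p (r σ) k * W σ τ := by simp
  rw [← h1, Finset.sum_congr rfl fun σ' _ => congrArg (· * W σ' τ) (h.coeff σ σ' k).symm]
  simp only [Finset.sum_mul]
  rw [Finset.sum_comm]
  have h2 : ∀ τ', (∑ σ', (if r τ' = k then W σ τ' * star (W σ' τ') else 0) * W σ' τ) =
      if r τ' = k then (if τ' = τ then W σ τ' else 0) else 0 := fun τ' => by
    split_ifs with hk ht
    · simp only [mul_assoc]
      rw [← Finset.mul_sum, h.col_star_mul, if_pos ht, mul_one]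
    · simp only [mul_assoc]
      rw [← Finset.mul_sum, h.col_star_mul, if_neg ht, mul_zero]
    · simp
  simp only [h2]
  rw [Finset.sum_eq_single τ (fun τ' _ hτ => by simp [hτ]) (by simp)]
  simp

theorem coeff_self (h : IsDiagonalNormalizer W r p) (σ : E) (k : V) :
    p (r σ) k = ∑ τ, if r τ = k then W σ τ * star (W σ τ) else 0 := by
  rw [h.coeff, if_pos rfl]

theorem star_coeff (h : IsDiagonalNormalizer W r p) (σ : E) (k : V) :
    star (p (r σ) k) = p (r σ) k := by
  rw [h.coeff_self, star_sum]
  refine Finset.sum_congr rfl fun τ _ => ?_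
  split_ifs <;> simp

/-- With the second factor expanded as `∑ W σ τ * star (W σ τ)` over the fibre of `l`, the first
factor acts on each term as `0` or `1` by `coeff_mul`. -/
theorem coeff_mul_coeff (h : IsDiagonalNormalizer W r p) (σ : E) (k l : V) :
    p (r σ) k * p (r σ) l = if k = l then p (r σ) l else 0 := by
  rw [h.coeff_self σ l, Finset.mul_sum]
  have h1 : ∀ τ, p (r σ) k * (if r τ = l then W σ τ * star (W σ τ) else 0) =
      if k = l then (if r τ = l then W σ τ * star (W σ τ) else 0) else 0 := fun τ => by
    by_cases hl : r τ = l
    · rw [if_pos hl, ← mul_assoc, h.coeff_mul, hl, ite_mul, zero_mul]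
      simp only [eq_comm]
    · simp [hl]
  simp only [h1]
  split_ifs <;> simp

theorem sum_coeff [Fintype V] (h : IsDiagonalNormalizer W r p) (σ : E) : ∑ k, p (r σ) k = 1 := by
  simp only [h.coeff_eq_sum]
  rw [Finset.sum_comm]
  simp [h.row_sum]

/-- Conjugation by the entrywise adjoint of `W` recovers the coefficients, if their columns are
orthogonal. -/
theorem sum_fiber (h : IsDiagonalNormalizer W r p)
    (ho : ∀ v w k, v ≠ w → p v k * p w k = 0) (v : V) (τ τ' : E) :
    (∑ σ, if r σ = v then W σ τ * star (W σ τ') else 0) = if τ = τ' then p v (r τ) else 0 := by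
  -- Multiplying the full column relation by `p v (r τ)` selects the rows over `v`: each `W σ τ`
  -- absorbs `p (r σ) (r τ)` on its left, which `p v (r τ)` kills by `ho` when `r σ ≠ v`.
  have h1 : p v (r τ) * ∑ σ, W σ τ * star (W σ τ') = if τ = τ' then p v (r τ) else 0 := by
    rw [h.col_mul_star]
    split_ifs <;> simp
  rw [← h1, Finset.mul_sum]
  refine Finset.sum_congr rfl fun σ _ => ?_
  have h2 : W σ τ = p (r σ) (r τ) * W σ τ := by rw [h.coeff_mul, if_pos rfl]
  split_ifs with hs
  · rw [← hs, ← mul_assoc, ← h2]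
  · rw [h2, ← mul_assoc, ← mul_assoc, ho v (r σ) _ (Ne.symm hs), zero_mul, zero_mul]

variable [PartialOrder A] [StarOrderedRing A]

theorem coeff_nonneg (h : IsDiagonalNormalizer W r p) (σ : E) (k : V) : 0 ≤ p (r σ) k := by
  rw [h.coeff_self]
  refine Finset.sum_nonneg fun τ _ => ?_
  split_ifs
  · exact mul_star_self_nonneg _
  · exact le_rfl

/-- If the coefficients leave `J` invariant, then they also leave its complement invariant. -/
theorem coeff_eq_zero_of_invariant [Fintype V] (h : IsDiagonalNormalizer W r p) (J : Set V)
    (hJ : ∀ k ∈ J, ∀ σ, r σ ∉ J → p (r σ) k = 0) (σ : E) (hσ : r σ ∈ J) (k : V) (hk : k ∉ J) :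
    p (r σ) k = 0 := by
  classical
  -- Column sums are taken over edges rather than vertices, since those are controlled by the column
  -- sums of `W`. For `k ∈ J`, invariance confines the sum to edges over `J`.
  have h1 : ∀ k ∈ J, ∑ σ ∈ Finset.univ.filter (r · ∈ J), p (r σ) k =
      ∑ τ, if r τ = k then (1 : A) else 0 := fun k hk => by
    rw [Finset.sum_filter_of_ne fun σ _ h0 => by_contra fun hn => h0 (hJ k hk σ hn)]
    simp only [h.coeff_eq_sum]
    rw [Finset.sum_comm]
    refine Finset.sum_congr rfl fun τ _ => ?_
    split_ifs
    · exact h.col_sum τ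
    · exact Finset.sum_const_zero
  -- Both sides equal the number of edges over `J`: the left by columns, the right because rows sum
  -- to `1`. The entries with `k ∉ J` are positive and hence have no room left.
  have h2 : ∑ σ ∈ Finset.univ.filter (r · ∈ J), ∑ k ∈ Finset.univ.filter (· ∈ J), p (r σ) k =
      ∑ σ ∈ Finset.univ.filter (r · ∈ J), ∑ k, p (r σ) k := by
    rw [Finset.sum_comm]
    rw [Finset.sum_congr rfl fun k hk => h1 k (Finset.mem_filter.mp hk).2, Finset.sum_comm]
    simp only [h.sum_coeff]
    rw [Finset.sum_filter]
    refine Finset.sum_congr rfl fun τ _ => ?_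
    rw [Finset.sum_ite_eq]
    simp
  have h3 : ∑ σ ∈ Finset.univ.filter (r · ∈ J), ∑ k ∈ Finset.univ.filter (· ∉ J), p (r σ) k =
      0 := by
    have h4 : ∀ σ, ∑ k, p (r σ) k = ∑ k ∈ Finset.univ.filter (· ∈ J), p (r σ) k +
        ∑ k ∈ Finset.univ.filter (· ∉ J), p (r σ) k := fun σ =>
      (Finset.sum_filter_add_sum_filter_not _ _ _).symm
    simp only [h4, Finset.sum_add_distrib] at h2
    exact left_eq_add.mp h2
  rw [Finset.sum_eq_zero_iff_of_nonneg
    fun σ _ => Finset.sum_nonneg fun k _ => h.coeff_nonneg σ k] at h3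
  have h5 := h3 σ (by simpa using hσ)
  rw [Finset.sum_eq_zero_iff_of_nonneg fun k _ => h.coeff_nonneg σ k] at h5
  exact h5 k (by simpa using hk)

/-- The column sums of the coefficients are at least `1`. -/
theorem one_le_sum_coeff [Fintype V] (h : IsDiagonalNormalizer W r p)
    (hp : ∀ v k, 0 ≤ p v k) (τ : E) : 1 ≤ ∑ v, p v (r τ) := by
  -- The rows over `v` contribute a positive `X ≤ 1` with `q * X = X`, where `q = p v (r τ)` is a
  -- projection. Then `q - X = q * (1 - X) * q ≥ 0`. Over all `v` these contributions add up to `1`.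
  have h1 : ∀ v, (∑ σ, if r σ = v then W σ τ * star (W σ τ) else 0) ≤ p v (r τ) := fun v => by
    by_cases hv : v ∈ Set.range r
    · obtain ⟨ρ, rfl⟩ := hv
      set q := p (r ρ) (r τ) with hq
      set X := ∑ σ, if r σ = r ρ then W σ τ * star (W σ τ) else 0 with hX
      have e1 : q * X = X := by
        rw [hX, Finset.mul_sum]
        refine Finset.sum_congr rfl fun σ _ => ?_
        split_ifs with hs
        · rw [hq, ← hs, ← mul_assoc, h.coeff_mul, if_pos rfl]
        · exact mul_zero _
      have e2 : star X = X := by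
        rw [hX, star_sum]
        refine Finset.sum_congr rfl fun σ _ => ?_
        split_ifs <;> simp
      have e3 : star q = q := h.star_coeff ρ _
      have e4 : X * q = X := by
        have := congrArg star e1
        rwa [star_mul, e2, e3] at this
      have e5 : q * q = q := by rw [hq, h.coeff_mul_coeff, if_pos rfl]
      have e6 : X ≤ 1 := by
        rw [← (h.col_mul_star τ τ).trans (if_pos rfl), hX]
        refine Finset.sum_le_sum fun σ _ => ?_
        split_ifs
        · exact le_rfl
        · exact mul_star_self_nonneg _
      have e7 := star_left_conjugate_nonneg (sub_nonneg.mpr e6) q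
      rw [e3, mul_sub, sub_mul, mul_one, e5, e1, e4] at e7
      exact sub_nonneg.mp e7
    -- Rows of `p` outside the range of `r` are not governed by `W`; only their positivity is
    -- available.
    · have h0 : (∑ σ, if r σ = v then W σ τ * star (W σ τ) else 0) = 0 :=
        Finset.sum_eq_zero fun σ _ => if_neg fun hs => hv ⟨σ, hs⟩
      rw [h0]
      exact hp v _
  calc (1 : A) = ∑ v, ∑ σ, if r σ = v then W σ τ * star (W σ τ) else 0 := by
        rw [Finset.sum_comm]
        simp [h.col_mul_star]
    _ ≤ _ := Finset.sum_le_sum fun v _ => h1 v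

end IsDiagonalNormalizer

/-! ### Bilinearity of elementary tensors -/

section MinTmul

variable {A B : Type u} [CStarAlgebra A] [CStarAlgebra B] {ι : Type v}

theorem minTmul_sum_left (s : Finset ι) (f : ι → A) (b : B) :
    minTmul (∑ i ∈ s, f i) b = ∑ i ∈ s, minTmul (f i) b := by
  simp only [minTmul, TensorProduct.sum_tmul, map_sum]

theorem minTmul_sum_right (s : Finset ι) (a : A) (f : ι → B) :
    minTmul a (∑ i ∈ s, f i) = ∑ i ∈ s, minTmul a (f i) := by
  simp only [minTmul, TensorProduct.tmul_sum, map_sum]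

theorem minTmul_smul_right (c : ℂ) (a : A) (b : B) : minTmul a (c • b) = c • minTmul a b := by
  simp only [minTmul, TensorProduct.tmul_smul, map_smul]

theorem minTmul_zero_left (b : B) : minTmul (0 : A) b = 0 := by
  simp only [minTmul, TensorProduct.zero_tmul, map_zero]

theorem minTmul_zero_right (a : A) : minTmul a (0 : B) = 0 := by
  simp only [minTmul, TensorProduct.tmul_zero, map_zero]

/-- Regroups a sum over edges by their endpoint. It turns the middle index of the co-product of `U`
from edges into vertices. -/
theorem sum_minTmul_comp {V : Type v} {E : Type w} [Fintype V] [DecidableEq V] [Fintype E]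
    (r : E → V) {a : E → A} {p : V → B} {q : V → A}
    (hq : ∀ w, q w = ∑ ρ, if r ρ = w then a ρ else 0) :
    ∑ ρ, minTmul (a ρ) (p (r ρ)) = ∑ w, minTmul (q w) (p w) := by
  simp only [hq, minTmul_sum_left]
  rw [Finset.sum_comm]
  refine Finset.sum_congr rfl fun ρ _ => ?_
  rw [Finset.sum_eq_single (r ρ)]
  · rw [if_pos rfl]
  · intro w _ hw
    rw [if_neg (Ne.symm hw), minTmul_zero_left]
  · intro hn
    exact absurd (Finset.mem_univ _) hn

end MinTmul

/-! ### Co-associativity and density in terms of matrices -/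

section FiniteDimensional

variable {A : Type u} [CStarAlgebra A] {X : Type v} [Fintype X] [DecidableEq X]

/-- A linear map on `X → ℂ` in terms of its values on the basis. -/
theorem apply_eq_sum_single (γ : (X → ℂ) →ₗ[ℂ] (X → A)) (f : X → ℂ) (x : X) :
    γ f x = ∑ y, f y • γ (Pi.single y 1) x := by
  conv_lhs => rw [pi_eq_sum_univ' f, map_sum, Finset.sum_apply]
  refine Finset.sum_congr rfl fun y _ => ?_
  rw [map_smul, Pi.smul_apply]

/-- A linear map whose matrix is comultiplicative satisfies `(γ ⊗ id) γ = (id ⊗ Δ) γ`. -/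
theorem ampId_eq_idAmp (Q : CompactQuantumGroup A) (γ : (X → ℂ) →ₗ[ℂ] (X → A))
    (h : ∀ x y, Q.comul (γ (Pi.single y 1) x) =
      ∑ z, minTmul (γ (Pi.single z 1) x) (γ (Pi.single y 1) z)) (f : X → ℂ) :
    ampId γ (γ f) = idAmp Q (γ f) := by
  funext x
  simp only [ampId, idAmp]
  rw [apply_eq_sum_single γ f x, map_sum]
  simp only [map_smul, h, Finset.smul_sum]
  rw [Finset.sum_comm]
  refine Finset.sum_congr rfl fun z _ => ?_
  rw [apply_eq_sum_single γ f z, minTmul_sum_right]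
  simp only [minTmul_smul_right]

/-- If the matrix of `γ` has a right inverse, then `γ(X → ℂ)(1 ⊗ A)` spans `(X → ℂ) ⊗ A`. -/
theorem dense_span_of_right_inverse (γ : (X → ℂ) →ₗ[ℂ] (X → A)) (q : X → X → A)
    (h : ∀ x z, ∑ y, γ (Pi.single y 1) x * q y z = if x = z then 1 else 0) :
    Dense (Submodule.span ℂ {F : X → A | ∃ f a, F = fun x => γ f x * a} : Set (X → A)) := by
  suffices hs : Submodule.span ℂ {F : X → A | ∃ f a, F = fun x => γ f x * a} = ⊤ by
    rw [hs]
    exact dense_univ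
  refine eq_top_iff.mpr fun F _ => ?_
  -- The right inverse solves for `F` with coefficients `∑ z, q y z * F z`, so the span is the whole
  -- space even before taking closures.
  have hF : F = ∑ z, ∑ y, fun x => γ (Pi.single y 1) x * (q y z * F z) := by
    funext x
    simp only [Finset.sum_apply, ← mul_assoc, ← Finset.sum_mul, h]
    simp
  rw [hF]
  exact Submodule.sum_mem _ fun z _ => Submodule.sum_mem _ fun y _ =>
    Submodule.subset_span ⟨_, _, rfl⟩

end FiniteDimensional

/-! ### The two normalizers attached to a Banica co-action -/

namespace Multigraph

variable {A : Type u} [CStarAlgebra A] {V : Type v} {E : Type w}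
variable [Fintype E] [DecidableEq E] [DecidableEq V]
variable {G : Multigraph V E} {Q : CompactQuantumGroup A} {β : (E → ℂ) →ₗ[ℂ] (E → A)}

theorem inducedCoeff_of_source {k v : V} (hk : k ∈ Set.range G.s) (hv : v ∈ Set.range G.s) :
    G.inducedCoeff β k v = G.inducedSource β (Pi.single ⟨k, hk⟩ 1) ⟨v, hv⟩ := by
  rw [inducedCoeff, dif_pos hk, dif_pos hv]

theorem inducedCoeff_of_source_notMem {k v : V} (hk : k ∈ Set.range G.s)
    (hv : v ∉ Set.range G.s) : G.inducedCoeff β k v = 0 := by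
  rw [inducedCoeff, dif_pos hk, dif_neg hv]

/-- The coefficient matrix `p` is left free because it is used twice: with entries cut off outside
`V^s`, to prove that the induced coefficients vanish there, and afterwards with the induced
coefficients themselves. -/
theorem isDiagonalNormalizer_source (h : G.IsBanicaCoaction Q β) (p : V → V → A)
    (hp : ∀ σ σ' k, (∑ τ, if G.s τ = k then corepMatrix β σ τ * star (corepMatrix β σ' τ) else 0) =
      if σ = σ' then p (G.s σ) k else 0) :
    IsDiagonalNormalizer (corepMatrix β) G.s p where
  row_sum σ := by
    have h1 := apply_eq_sum_single β (fun _ => 1) σ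
    rw [h.fix] at h1
    simpa [corepMatrix] using h1.symm
  col_star_mul τ τ' := by
    have h1 := congrFun (congrFun (Unitary.mem_iff.mp h.corep.unitary_matrix).1 τ) τ'
    simpa [Matrix.mul_apply, Matrix.star_eq_conjTranspose, Matrix.one_apply] using h1
  col_mul_star τ τ' := by
    have h1 := congrFun (congrFun (Unitary.mem_iff.mp h.corep.unitary_conj).1 τ) τ'
    simpa [Matrix.mul_apply, Matrix.star_eq_conjTranspose, Matrix.one_apply] using h1
  coeff := hp

/-- Passing to `Ū` exchanges the roles of the two unitarity conditions, and the row sums survive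
since `1` is self-adjoint. -/
theorem isDiagonalNormalizer_target (h : G.IsBanicaCoaction Q β) (p : V → V → A)
    (hp : ∀ σ σ' k, (∑ τ, if G.t τ = k then
      star (corepMatrix β σ τ) * star (star (corepMatrix β σ' τ)) else 0) =
      if σ = σ' then p (G.t σ) k else 0) :
    IsDiagonalNormalizer (fun σ τ => star (corepMatrix β σ τ)) G.t p where
  row_sum σ := by
    have h1 := apply_eq_sum_single β (fun _ => 1) σ
    rw [h.fix] at h1
    have h2 := congrArg star h1
    simpa [corepMatrix] using h2.symm
  col_star_mul τ τ' := by
    have h1 := congrFun (congrFun (Unitary.mem_iff.mp h.corep.unitary_conj).1 τ) τ'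
    simpa [Matrix.mul_apply, Matrix.star_eq_conjTranspose, Matrix.one_apply] using h1
  col_mul_star τ τ' := by
    have h1 := congrFun (congrFun (Unitary.mem_iff.mp h.corep.unitary_matrix).1 τ) τ'
    simpa [Matrix.mul_apply, Matrix.star_eq_conjTranspose, Matrix.one_apply] using h1
  coeff := hp

theorem source_coeff (h : G.IsBanicaCoaction Q β) (σ σ' : E) {k : V} (hk : k ∈ Set.range G.s) :
    (∑ τ, if G.s τ = k then corepMatrix β σ τ * star (corepMatrix β σ' τ) else 0) =
      if σ = σ' then G.inducedCoeff β k (G.s σ) else 0 := by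
  have h1 := congrFun (congrFun (G.sourceDiag_inducedSource β (Pi.single ⟨k, hk⟩ 1)
    (h.source _)) σ) σ'
  rw [sourceDiag, Matrix.diagonal_apply, ← inducedCoeff_of_source hk ⟨σ, rfl⟩] at h1
  rw [h1, adSource, conjAd, Matrix.mul_apply]
  refine Finset.sum_congr rfl fun τ _ => ?_
  rw [sourceDiag, Matrix.diagonal_map (map_zero _), Matrix.mul_diagonal,
    Matrix.conjTranspose_apply]
  simp only [Pi.single_apply, Subtype.ext_iff]
  by_cases hτ : G.s τ = k <;> simp [hτ]

variable [Fintype V]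

theorem inducedVertex_apply (β : (E → ℂ) →ₗ[ℂ] (E → A)) (f : V → ℂ) (v : V) :
    G.inducedVertex β f v = ∑ k, f k • G.inducedCoeff β k v := rfl

/-- The coefficients are defined with preference for the source, so on `V^s ∩ V^t` this rests on the
invariance and agreement of `α_s` and `α_t`. -/
theorem inducedCoeff_of_target (h : G.IsBanicaCoaction Q β) {k v : V} (hk : k ∈ Set.range G.t)
    (hv : v ∈ Set.range G.t) :
    G.inducedCoeff β k v = G.inducedTarget β (Pi.single ⟨k, hk⟩ 1) ⟨v, hv⟩ := by
  rw [← inducedVertex_single, inducedVertex_of_target G h k hk]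
  exact dif_pos hv

theorem inducedCoeff_of_target_notMem (h : G.IsBanicaCoaction Q β) {k v : V}
    (hk : k ∈ Set.range G.t) (hv : v ∉ Set.range G.t) : G.inducedCoeff β k v = 0 := by
  rw [← inducedVertex_single, inducedVertex_of_target G h k hk]
  exact dif_neg hv

theorem target_coeff (h : G.IsBanicaCoaction Q β) (σ σ' : E) {k : V} (hk : k ∈ Set.range G.t) :
    (∑ τ, if G.t τ = k then star (corepMatrix β σ τ) * star (star (corepMatrix β σ' τ)) else 0) =
      if σ = σ' then G.inducedCoeff β k (G.t σ) else 0 := by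
  have h1 := congrFun (congrFun (G.targetDiag_inducedTarget β (Pi.single ⟨k, hk⟩ 1)
    (h.target _)) σ) σ'
  rw [targetDiag, Matrix.diagonal_apply, ← inducedCoeff_of_target h hk ⟨σ, rfl⟩] at h1
  rw [h1, adTarget, conjAd, Matrix.mul_apply]
  refine Finset.sum_congr rfl fun τ _ => ?_
  rw [targetDiag, Matrix.diagonal_map (map_zero _), Matrix.mul_diagonal,
    Matrix.conjTranspose_apply]
  simp only [Pi.single_apply, Subtype.ext_iff]
  by_cases hτ : G.t τ = k <;> simp [hτ]

/-! ### Vanishing of the coefficients across `V^s` and `V^t` -/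

section Order

variable [PartialOrder A] [StarOrderedRing A]

-- `α_t` maps `C(V^s ∩ V^t)` into itself; by the counting argument it then also preserves the
-- functions on `V^t` that vanish on `V^s`.
open Classical in
theorem inducedCoeff_eq_zero_of_notMem_source (h : G.IsBanicaCoaction Q β) {k v : V}
    (hk : k ∉ Set.range G.s) (hkt : k ∈ Set.range G.t) (hv : v ∈ Set.range G.s) :
    G.inducedCoeff β k v = 0 := by
  by_cases hvt : v ∈ Set.range G.t
  · obtain ⟨σ, rfl⟩ := hvt
    -- The cut-off is needed because the coefficients with `k ∉ V^t` are not yet known to vanish at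
    -- targets.
    have hn := isDiagonalNormalizer_target h
      (fun v k => if k ∈ Set.range G.t then G.inducedCoeff β k v else 0) (fun σ σ' k => by
        by_cases hk : k ∈ Set.range G.t
        · simp only [if_pos hk]
          exact target_coeff h σ σ' hk
        · simp only [if_neg hk, ite_self]
          exact Finset.sum_eq_zero fun τ _ => if_neg fun hτ => hk ⟨τ, hτ⟩)
    have h1 := hn.coeff_eq_zero_of_invariant (Set.range G.s) (fun k hk σ hσ => by
      split_ifs
      · exact inducedCoeff_of_source_notMem hk hσ
      · rfl) σ hv k hk
    rwa [if_pos hkt] at h1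
  · exact inducedCoeff_of_target_notMem h hkt hvt

open Classical in
theorem inducedCoeff_eq_zero_of_notMem_target (h : G.IsBanicaCoaction Q β) {k v : V}
    (hk : k ∉ Set.range G.t) (hks : k ∈ Set.range G.s) (hv : v ∈ Set.range G.t) :
    G.inducedCoeff β k v = 0 := by
  by_cases hvs : v ∈ Set.range G.s
  · obtain ⟨σ, rfl⟩ := hvs
    have hn := isDiagonalNormalizer_source h
      (fun v k => if k ∈ Set.range G.s then G.inducedCoeff β k v else 0) (fun σ σ' k => by
        by_cases hk : k ∈ Set.range G.s
        · simp only [if_pos hk]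
          exact source_coeff h σ σ' hk
        · simp only [if_neg hk, ite_self]
          exact Finset.sum_eq_zero fun τ _ => if_neg fun hτ => hk ⟨τ, hτ⟩)
    have h1 := hn.coeff_eq_zero_of_invariant (Set.range G.t) (fun k hk σ hσ => by
      split_ifs
      · exact inducedCoeff_of_target_notMem h hk hσ
      · rfl) σ hv k hk
    rwa [if_pos hks] at h1
  · exact inducedCoeff_of_source_notMem hks hvs

/-- For `k ∉ V^s` the fibre of `s` is empty, so the relation demands that the coefficient vanish on
`V^s`. Absence of isolated vertices puts such a `k` in `V^t`, where the counting argument applies.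
-/
theorem source_normalizer (hG : G.NoIsolated) (h : G.IsBanicaCoaction Q β) :
    IsDiagonalNormalizer (corepMatrix β) G.s fun v k => G.inducedCoeff β k v :=
  isDiagonalNormalizer_source h _ fun σ σ' k => by
    by_cases hk : k ∈ Set.range G.s
    · exact source_coeff h σ σ' hk
    · rw [inducedCoeff_eq_zero_of_notMem_source h hk ((hG k).resolve_left hk) ⟨σ, rfl⟩, ite_self]
      exact Finset.sum_eq_zero fun τ _ => if_neg fun hτ => hk ⟨τ, hτ⟩

theorem target_normalizer (hG : G.NoIsolated) (h : G.IsBanicaCoaction Q β) :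
    IsDiagonalNormalizer (fun σ τ => star (corepMatrix β σ τ)) G.t
      fun v k => G.inducedCoeff β k v :=
  isDiagonalNormalizer_target h _ fun σ σ' k => by
    by_cases hk : k ∈ Set.range G.t
    · exact target_coeff h σ σ' hk
    · rw [inducedCoeff_eq_zero_of_notMem_target h hk ((hG k).resolve_right hk) ⟨σ, rfl⟩, ite_self]
      exact Finset.sum_eq_zero fun τ _ => if_neg fun hτ => hk ⟨τ, hτ⟩

/-! ### The induced coefficients form a magic unitary -/

theorem inducedCoeff_nonneg (hG : G.NoIsolated) (h : G.IsBanicaCoaction Q β) (k v : V) :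
    0 ≤ G.inducedCoeff β k v := by
  obtain ⟨σ, rfl⟩ | ⟨σ, rfl⟩ := hG v
  · exact (source_normalizer hG h).coeff_nonneg σ k
  · exact (target_normalizer hG h).coeff_nonneg σ k

theorem star_inducedCoeff (hG : G.NoIsolated) (h : G.IsBanicaCoaction Q β) (k v : V) :
    star (G.inducedCoeff β k v) = G.inducedCoeff β k v := by
  obtain ⟨σ, rfl⟩ | ⟨σ, rfl⟩ := hG v
  · exact (source_normalizer hG h).star_coeff σ k
  · exact (target_normalizer hG h).star_coeff σ k

theorem inducedCoeff_mul (hG : G.NoIsolated) (h : G.IsBanicaCoaction Q β) (k l v : V) :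
    G.inducedCoeff β k v * G.inducedCoeff β l v = if k = l then G.inducedCoeff β l v else 0 := by
  obtain ⟨σ, rfl⟩ | ⟨σ, rfl⟩ := hG v
  · exact (source_normalizer hG h).coeff_mul_coeff σ k l
  · exact (target_normalizer hG h).coeff_mul_coeff σ k l

theorem sum_inducedCoeff (hG : G.NoIsolated) (h : G.IsBanicaCoaction Q β) (v : V) :
    ∑ k, G.inducedCoeff β k v = 1 := by
  obtain ⟨σ, rfl⟩ | ⟨σ, rfl⟩ := hG v
  · exact (source_normalizer hG h).sum_coeff σ
  · exact (target_normalizer hG h).sum_coeff σ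

/-- Each column sum exceeds `1` by a positive element. The row sums make the total excess over the
square matrix zero, so every excess vanishes. -/
theorem col_sum_inducedCoeff (hG : G.NoIsolated) (h : G.IsBanicaCoaction Q β) (k : V) :
    ∑ v, G.inducedCoeff β k v = 1 := by
  have h1 : ∀ k, 0 ≤ (∑ v, G.inducedCoeff β k v) - 1 := fun k => by
    rw [sub_nonneg]
    obtain ⟨τ, rfl⟩ | ⟨τ, rfl⟩ := hG k
    · exact (source_normalizer hG h).one_le_sum_coeff (fun v k => inducedCoeff_nonneg hG h k v) τ
    · exact (target_normalizer hG h).one_le_sum_coeff (fun v k => inducedCoeff_nonneg hG h k v) τ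
  have h2 : ∑ k, ((∑ v, G.inducedCoeff β k v) - 1) = 0 := by
    rw [Finset.sum_sub_distrib, Finset.sum_comm]
    simp only [sum_inducedCoeff hG h, sub_self]
  rw [Finset.sum_eq_zero_iff_of_nonneg fun k _ => h1 k] at h2
  exact sub_eq_zero.mp (h2 k (Finset.mem_univ k))

theorem inducedCoeff_mul_of_ne (hG : G.NoIsolated) (h : G.IsBanicaCoaction Q β) (k : V) {v w : V}
    (hvw : v ≠ w) : G.inducedCoeff β k v * G.inducedCoeff β k w = 0 :=
  mul_eq_zero_of_sum_eq_one (p := G.inducedCoeff β k) (star_inducedCoeff hG h k)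
    (fun v => by rw [inducedCoeff_mul hG h, if_pos rfl]) (col_sum_inducedCoeff hG h k) hvw

theorem inducedCoeff_source_eq_sum (hG : G.NoIsolated) (h : G.IsBanicaCoaction Q β) (k : V)
    (σ : E) : G.inducedCoeff β k (G.s σ) = ∑ τ, if G.s τ = k then corepMatrix β σ τ else 0 :=
  (source_normalizer hG h).coeff_eq_sum σ k

/-- The target normalizer yields a sum of adjoints of entries of `U`. Self-adjointness of the
coefficient removes the adjoints, so that the co-product formula for `U` applies to both endpoints.
-/
theorem inducedCoeff_target_eq_sum (hG : G.NoIsolated) (h : G.IsBanicaCoaction Q β) (k : V)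
    (σ : E) : G.inducedCoeff β k (G.t σ) = ∑ τ, if G.t τ = k then corepMatrix β σ τ else 0 := by
  have h1 := congrArg star ((target_normalizer hG h).coeff_eq_sum σ k)
  rw [star_inducedCoeff hG h, star_sum] at h1
  rw [h1]
  refine Finset.sum_congr rfl fun τ _ => ?_
  split_ifs <;> simp

theorem comul_inducedCoeff (hG : G.NoIsolated) (h : G.IsBanicaCoaction Q β) (k v : V) :
    Q.comul (G.inducedCoeff β k v) =
      ∑ w, minTmul (G.inducedCoeff β w v) (G.inducedCoeff β k w) := by
  -- Summing the co-product of `U` over the fibre of `k` collapses the right leg to a coefficient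
  -- depending only on `r ρ`; grouping the `ρ` by `r ρ` then collapses the left leg.
  have key : ∀ (r : E → V) (σ : E), (∀ σ k, G.inducedCoeff β k (r σ) =
      ∑ τ, if r τ = k then corepMatrix β σ τ else 0) → Q.comul (G.inducedCoeff β k (r σ)) =
      ∑ w, minTmul (G.inducedCoeff β w (r σ)) (G.inducedCoeff β k w) := fun r σ hr => by
    rw [← sum_minTmul_comp r (a := fun ρ => corepMatrix β σ ρ) (p := fun w => G.inducedCoeff β k w)
      (fun w => hr σ w), hr σ k, map_sum]
    simp only [hr, minTmul_sum_right]
    rw [Finset.sum_comm]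
    refine Finset.sum_congr rfl fun τ _ => ?_
    split_ifs
    · exact h.corep.comul_matrix σ τ
    · simp only [map_zero, minTmul_zero_right, Finset.sum_const_zero]
  obtain ⟨σ, rfl⟩ | ⟨σ, rfl⟩ := hG v
  · exact key G.s σ fun σ k => inducedCoeff_source_eq_sum hG h k σ
  · exact key G.t σ fun σ k => inducedCoeff_target_eq_sum hG h k σ

/-! ### Verification of the co-action axioms -/

theorem isCoaction_inducedVertex (hG : G.NoIsolated) (h : G.IsBanicaCoaction Q β) :
    IsCoaction Q (G.inducedVertex β) where
  map_one := by
    funext v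
    simp only [inducedVertex_apply, Pi.one_apply, one_smul, sum_inducedCoeff hG h]
  map_mul f g := by
    funext v
    simp only [inducedVertex_apply, Pi.mul_apply, Finset.sum_mul_sum, smul_mul_smul_comm,
      inducedCoeff_mul hG h, smul_ite, smul_zero, Finset.sum_ite_eq, Finset.mem_univ, if_true]
  map_star f := by
    funext v
    simp only [inducedVertex_apply, Pi.star_apply, star_sum, star_smul, star_inducedCoeff hG h]
  coassoc := ampId_eq_idAmp Q _ fun v k => by
    simp only [inducedVertex_single]
    exact comul_inducedCoeff hG h k v
  -- The right inverse of a magic unitary is its transpose: the diagonal entries of the product are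
  -- row sums of projections, and the others vanish by orthogonality within columns.
  dense := dense_span_of_right_inverse _ (fun k w => G.inducedCoeff β k w) fun v w => by
    simp only [inducedVertex_single]
    split_ifs with hvw
    · subst hvw
      simp only [inducedCoeff_mul hG h, if_true, sum_inducedCoeff hG h]
    · exact Finset.sum_eq_zero fun k _ => inducedCoeff_mul_of_ne hG h k hvw

theorem left_equivariant_inducedVertex (hG : G.NoIsolated) (h : G.IsBanicaCoaction Q β)
    (f : V → ℂ) (ξ : E → ℂ) :
    β (G.correspondence.φ f ξ) = G.correspondence.φAmp (G.inducedVertex β f) (β ξ) := by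
  have h1 : ∀ i τ σ, G.correspondence.φ (Pi.single i 1) (Pi.single τ 1) σ =
      if G.s σ = i then (if σ = τ then 1 else 0) else 0 := fun i τ σ => by
    change (Pi.single i 1 : V → ℂ) (G.s σ) * (Pi.single τ 1 : E → ℂ) σ = _
    simp only [Pi.single_apply]
    split_ifs <;> simp
  have h2 : ∀ τ, G.correspondence.φ f ξ τ = f (G.s τ) * ξ τ := fun τ => rfl
  funext σ
  have h3 : G.correspondence.φAmp (G.inducedVertex β f) (β ξ) σ =
      G.inducedVertex β f (G.s σ) * β ξ σ := by
    rw [FiniteCorrespondence.φAmp]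
    simp [h1, ite_smul]
  rw [h3, apply_eq_sum_single β ξ σ, apply_eq_sum_single β _ σ, Finset.mul_sum]
  refine Finset.sum_congr rfl fun τ _ => ?_
  rw [inducedVertex_apply, Finset.sum_mul, h2]
  -- By `coeff_mul`, only the term `k = s(τ)` of `α(f)` survives multiplication by `U σ τ`.
  have h4 : ∀ k, f k • G.inducedCoeff β k (G.s σ) * ξ τ • β (Pi.single τ 1) σ =
      if G.s τ = k then (f k * ξ τ) • β (Pi.single τ 1) σ else 0 := fun k => by
    have h5 := (source_normalizer hG h).coeff_mul σ τ k
    rw [smul_mul_smul_comm]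
    change _ • (_ * corepMatrix β σ τ) = _
    rw [h5, smul_ite, smul_zero]
    rfl
  simp [h4]

theorem ip_preserving_inducedVertex (hG : G.NoIsolated) (h : G.IsBanicaCoaction Q β)
    (ξ η : E → ℂ) : G.correspondence.ipAmp (β ξ) (β η) =
      G.inducedVertex β (G.correspondence.ip ξ η) := by
  have h0 : ∀ (ξ η : E → ℂ) v, G.correspondence.ip ξ η v =
    ∑ σ, if G.t σ = v then star (ξ σ) * η σ else 0 := fun _ _ _ => rfl
  have h1 : ∀ σ τ v, G.correspondence.ip (Pi.single σ 1) (Pi.single τ 1) v =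
      if σ = τ then (if G.t σ = v then 1 else 0) else 0 := fun σ τ v => by
    rw [h0, Finset.sum_eq_single σ]
    · simp only [Pi.single_apply]
      split_ifs <;> simp
    · intro ρ _ hρ
      simp [hρ]
    · intro hn
      exact absurd (Finset.mem_univ _) hn
  funext v
  have h2 : G.correspondence.ipAmp (β ξ) (β η) v =
      ∑ σ, if G.t σ = v then star (β ξ σ) * β η σ else 0 := by
    rw [FiniteCorrespondence.ipAmp]
    simp [h1, ite_smul]
  -- This is the claim for `ξ = χ_τ` and `η = χ_τ'`. It is where column orthogonality enters,
  -- through `sum_fiber` for the entrywise adjoint of `U`.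
  have h3 : ∀ τ τ', (∑ σ, if G.t σ = v then star (corepMatrix β σ τ) * corepMatrix β σ τ' else 0) =
      if τ = τ' then G.inducedCoeff β (G.t τ) v else 0 := fun τ τ' => by
    have h4 := (target_normalizer hG h).sum_fiber
      (fun v w k hvw => inducedCoeff_mul_of_ne hG h k hvw) v τ τ'
    simpa only [star_star] using h4
  have h5 : ∀ σ, (if G.t σ = v then star (β ξ σ) * β η σ else 0) =
      ∑ τ, ∑ τ', (star (ξ τ) * η τ') •
        (if G.t σ = v then star (corepMatrix β σ τ) * corepMatrix β σ τ' else 0) := fun σ => by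
    split_ifs
    · rw [apply_eq_sum_single β ξ σ, apply_eq_sum_single β η σ, star_sum, Finset.sum_mul_sum]
      simp only [star_smul, smul_mul_smul_comm]
      rfl
    · simp
  rw [h2, inducedVertex_apply]
  calc _ = ∑ τ, ∑ τ', (star (ξ τ) * η τ') •
        ∑ σ, (if G.t σ = v then star (corepMatrix β σ τ) * corepMatrix β σ τ' else 0) := by
        simp only [h5, Finset.smul_sum]
        rw [Finset.sum_comm]
        exact Finset.sum_congr rfl fun τ _ => Finset.sum_comm
    _ = ∑ τ, (star (ξ τ) * η τ) • G.inducedCoeff β (G.t τ) v := by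
        simp [h3]
    _ = _ := by
        simp only [h0, Finset.sum_smul, ite_smul, zero_smul]
        rw [Finset.sum_comm]
        simp

theorem isCorrespondenceCoaction_inducedVertex (hG : G.NoIsolated)
    (h : G.IsBanicaCoaction Q β) :
    IsCorrespondenceCoaction Q G.correspondence β (G.inducedVertex β) where
  coaction := isCoaction_inducedVertex hG h
  coassoc := ampId_eq_idAmp Q β fun σ τ => h.corep.comul_matrix σ τ
  dense := dense_span_of_right_inverse β (fun τ σ => star (corepMatrix β σ τ)) fun σ σ' => by
    have h1 := congrFun (congrFun (Unitary.mem_iff.mp h.corep.unitary_matrix).2 σ) σ'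
    rwa [Matrix.mul_apply, Matrix.one_apply] at h1
  left_equivariant := left_equivariant_inducedVertex hG h
  ip_preserving := ip_preserving_inducedVertex hG h

end Order

end Multigraph

theorem mainTheorem12 {A : Type u} [CStarAlgebra A] (Q : CompactQuantumGroup A)
    {V : Type v} {E : Type w} [Fintype V] [DecidableEq V] [Fintype E] [DecidableEq E]
    (G : Multigraph V E) (hG : G.NoIsolated)
    (β : (E → ℂ) →ₗ[ℂ] (E → A)) (hβ : G.IsBanicaCoaction Q β) :
    IsCorrespondenceCoaction Q G.correspondence β (G.inducedVertex β) := by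
  -- The positivity arguments use the spectral order, which does not occur in the statement.
  let _ := CStarAlgebra.spectralOrder A
  let _ := CStarAlgebra.spectralOrderedRing A
  exact Multigraph.isCorrespondenceCoaction_inducedVertex hG hβ
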